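/- Conventions. Let $D$ be a diagram, on the sphere $S^2$ (equivalently, on a disc), of an unoriented framed link, with $N$ crossings, which are ordered. A Kauffman state $s$ assigns a marker $\pm 1$ to every crossing of $D$; smoothing each crossing according to its marker (a positive marker joins the two regions that the overcrossing strand sweeps when it is rotated counterclockwise to the undercrossing strand, a negative marker joins the other two) gives a system of $|s|$ circles. Let $s_+$ and $s_-$ be the states with all markers positive, respectively all negative. An enhanced state $S$ is a state $s$ together with a sign $\pm$ on each of its circles; $\sigma(S)$ is the sum of its markers and $\tau(S)$ the sum of the signs of its circles. Let $C_{i,j}(D)$ be the free abelian group on the enhanced states with $\sigma(S)=i$ and $\sigma(S)+2\tau(S)=j$. The differential $d\colon C_{i,j}(D)\to C_{i-2,j}(D)$ is $d(S)=\sum_{S'}(-1)^{t(S:S')}[S:S']\,S'$, where $[S:S']=1$ if the markers of $S$ and $S'$ differ at exactly one crossing $c$ (positive in $S$, negative in $S'$) and all circles not touching $c$ have the same sign in $S$ and $S'$, where $[S:S']=0$ otherwise, and where $t(S:S')$ is the number of negative markers of $S$ at crossings bigger than $c$. The Khovanov homology of $D$ is $H_{i,j}(D)=\ker(d|_{C_{i,j}(D)})/d(C_{i+2,j}(D))$,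 and $T_{i,j}(D)$ is its torsion subgroup. For integers $k_1,k_2$ the diagram $D$ is called $H$-$(k_1,k_2)$-thick (respectively $TH$-$(k_1,k_2)$-thick) if $H_{i,j}(D)=0$ (respectively $T_{i,j}(D)=0$) for all integers $i,j$, with the possible exception of those satisfying $$N-2|s_-|-4k_2\le j-2i\le 2|s_+|-N+4k_1 .$$ The diagram $D$ is non-split if it is not a disjoint union of two non-empty diagrams (i.e. its underlying system of curves is connected). A crossing is nugatory if some simple closed curve meets $D$ only at that crossing, passing through it from one region corner to the opposite one. For an integer $k\ge 0$, $D$ is $k$-almost alternating if it becomes alternating after changing $k$ of its crossings. Corollary 5.8. Let $k\ge 0$ be an integer and let $D$ be a non-split $k$-almost alternating diagram without a nugatory crossing. Then $D$ is $H$-$(k,k)$-thick and $TH$-$(k,k-1)$-thick. That is, $H_{i,j}(D)\neq 0$ implies $$N-2|s_-|-4k\le j-2i\le 2|s_+|-N+4k,$$ and $T_{i,j}(D)\neq 0$ implies $$N-2|s_-|-4(k-1)\le j-2i\le 2|s_+|-N+4k .$$ -/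

import Mathlib

/-- The half-edges (darts) of a four-valent graph with vertex set `C`: the darts at the vertex `c`
are `(c, 0), (c, 1), (c, 2), (c, 3)`, listed in counterclockwise order around `c`. -/
abbrev Dart (C : Type*) : Type _ := C × ZMod 4

/-- A four-valent graph with vertex set `C` embedded in an oriented closed surface, given as a
combinatorial map: around each vertex the four darts come in the cyclic order of `ZMod 4`, and
`glue` matches each dart with the other end of its edge. Loops and multiple edges are allowed. -/
structure FourValentMap (C : Type*) where
  glue : Dart C → Dart C
  glue_glue : ∀ x, glue (glue x) = x
  glue_ne : ∀ x, glue x ≠ x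

namespace FourValentMap

variable {C : Type*} (G : FourValentMap C)

/-- The edges: pairs of matched darts. -/
def Edge : Type _ := Quot fun x y : Dart C => y = G.glue x

/-- The boundary walk of the faces. The dart `x` also stands for the corner between `x` and the
next dart counterclockwise, which lies on the left when one leaves the vertex along `x`. Following
the edge of `x` with this face on the left, one arrives along the dart `G.glue x` and leaves along
the dart that precedes it counterclockwise. -/
def faceNext (x : Dart C) : Dart C := ((G.glue x).1, (G.glue x).2 - 1)

/-- The faces (regions): orbits of `faceNext`, that is, classes of corners. -/
def Face : Type _ := Quot fun x y : Dart C => y = G.faceNext x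

/-- The face that contains the corner `x`. -/
def faceOf (x : Dart C) : G.Face := Quot.mk _ x

/-- The connected components of the graph. -/
def Component : Type _ := Quot fun c c' : C => ∃ a b : ZMod 4, G.glue (c, a) = (c', b)

/-- All components of the surface are spheres, by Euler's formula `V - E + F = 2 · #components`. -/
def IsPlanar : Prop :=
  (Nat.card C : ℤ) - (Nat.card G.Edge : ℤ) + (Nat.card G.Face : ℤ) = 2 * (Nat.card G.Component : ℤ)

end FourValentMap

/-- A diagram on the sphere (equivalently on the disc, up to the choice of the outer region) of an
unoriented framed link, with set of crossings `C`: a planar four-valent map, the over/under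
information at each crossing, and a number `loops` of simple closed curves without crossings.
`isOver (c, a)` says that the dart `(c, a)` belongs to the overcrossing strand at `c`. -/
structure LinkDiagram (C : Type*) extends FourValentMap C where
  planar : toFourValentMap.IsPlanar
  isOver : Dart C → Bool
  isOver_next : ∀ (c : C) (a : ZMod 4), isOver (c, a + 1) = !isOver (c, a)
  loops : ℕ

namespace LinkDiagram

variable {C : Type*} (D : LinkDiagram C)

/-- The diagram is non-split: it is not a disjoint union of two non-empty diagrams, i.e. its
underlying plane curve system is connected. -/
def IsNonSplit : Prop := Nat.card D.Component + D.loops ≤ 1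

/-- The crossing `c` is nugatory: two opposite corners at `c` lie in one region, i.e. a simple
closed curve meets the diagram at `c` only, passing through `c` from corner to opposite corner. -/
def IsNugatory (c : C) : Prop := ∃ a : ZMod 4, D.faceOf (c, a) = D.faceOf (c, a + 2)

/-- Alternating: along each strand overpasses and underpasses alternate, i.e. every edge is an
overpass at one end and an underpass at the other. -/
def IsAlternating : Prop := ∀ x : Dart C, D.isOver (D.glue x) = !D.isOver x

/-- Change all the crossings that belong to `T`. -/
def changeCrossings [DecidableEq C] (T : Finset C) : LinkDiagram C where
  toFourValentMap := D.toFourValentMap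
  planar := D.planar
  isOver x := if x.1 ∈ T then !D.isOver x else D.isOver x
  isOver_next c a := by
    by_cases h : c ∈ T <;> simp [h, D.isOver_next]
  loops := D.loops

/-- The diagram becomes alternating after changing `k` of its crossings. -/
def IsAlmostAlternating [DecidableEq C] (k : ℕ) : Prop :=
  ∃ T : Finset C, T.card = k ∧ (D.changeCrossings T).IsAlternating

/-! ### Kauffman states and the Khovanov complex -/

/-- A Kauffman state: a marker `1` or `-1` at each crossing. -/
abbrev State (C : Type*) : Type _ := C → ℤˣ

/-- The smoothing of the crossings according to the markers: `D.arc s x` is the dart to which `x`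
is connected. A positive marker opens the two corners swept by the overcrossing strand when it is
rotated counterclockwise, so that an overcrossing dart is connected to the preceding dart and an
undercrossing dart to the following one; a negative marker does the opposite. -/
def arc (s : State C) (x : Dart C) : Dart C :=
  (x.1, if D.isOver x then x.2 - (((s x.1 : ℤˣ) : ℤ) : ZMod 4)
    else x.2 + (((s x.1 : ℤˣ) : ℤ) : ZMod 4))

/-- The circles of the smoothed diagram: closed curves made of edges and arcs of smoothings, and
the crossingless components of the diagram. -/
def Circle (s : State C) : Type _ :=
  (Quot fun x y : Dart C => y = D.glue x ∨ y = D.arc s x) ⊕ Fin D.loops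

/-- The circle that passes through the dart `x`. -/
def circleOf (s : State C) (x : Dart C) : D.Circle s := Sum.inl (Quot.mk _ x)

/-- A crossingless component of the diagram, as a circle of the smoothed diagram. -/
def loopCircle (s : State C) (l : Fin D.loops) : D.Circle s := Sum.inr l

noncomputable instance [Fintype C] (s : State C) : Fintype (D.Circle s) :=
  haveI : Finite (D.Circle s) := by unfold Circle; infer_instance
  Fintype.ofFinite _

/-- `|s|`, the number of circles of the state. -/
noncomputable def numCircles (s : State C) : ℕ := Nat.card (D.Circle s)

/-- The state `s₊` with all markers positive. -/
def posState (C : Type*) : State C := fun _ => 1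

/-- The state `s₋` with all markers negative. -/
def negState (C : Type*) : State C := fun _ => -1

/-- An enhanced Kauffman state: a state together with a sign for each of its circles. -/
structure EnhancedState where
  marker : State C
  sign : D.Circle marker → ℤˣ

noncomputable instance [Fintype C] : Fintype D.EnhancedState :=
  haveI : Finite D.EnhancedState := by
    classical
    exact Finite.of_injective
      (fun S => (⟨S.marker, S.sign⟩ : (s : State C) × (D.Circle s → ℤˣ)))
      (by rintro ⟨m, e⟩ ⟨m', e'⟩ h; cases h; rfl)
  Fintype.ofFinite _

section Complex

variable {D} [Fintype C]

/-- `σ(S)`: the number of positive markers minus the number of negative markers. -/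
def EnhancedState.sigma (S : D.EnhancedState) : ℤ := ∑ c : C, (S.marker c : ℤ)

/-- `τ(S)`: the number of positive circles minus the number of negative circles. -/
noncomputable def EnhancedState.tau (S : D.EnhancedState) : ℤ :=
  ∑ γ : D.Circle S.marker, (S.sign γ : ℤ)

/-- The second degree `σ(S) + 2 τ(S)`. -/
noncomputable def EnhancedState.deg (S : D.EnhancedState) : ℤ := S.sigma + 2 * S.tau

/-- `[S : S'] = 1`, with `c` the crossing where the markers differ: the marker of `S` at `c` is
positive and that of `S'` is negative, all other markers agree, circles that do not touch `c` (they
are the same for `S` and `S'`) have the same sign in `S` and `S'`, and the second degrees agree. -/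
def Incident (c : C) (S S' : D.EnhancedState) : Prop :=
  S.marker c = 1 ∧ S'.marker c = -1 ∧ (∀ c', c' ≠ c → S'.marker c' = S.marker c') ∧
  (∀ x : Dart C, (∀ a : ZMod 4, D.circleOf S.marker (c, a) ≠ D.circleOf S.marker x) →
    S'.sign (D.circleOf S'.marker x) = S.sign (D.circleOf S.marker x)) ∧
  (∀ l : Fin D.loops,
    S'.sign (D.loopCircle S'.marker l) = S.sign (D.loopCircle S.marker l)) ∧
  S'.deg = S.deg

variable [LinearOrder C]

/-- `t(S : S')`: the number of negative markers of `S` at crossings bigger than `c`. -/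
def negAbove (c : C) (S : D.EnhancedState) : ℕ :=
  (Finset.univ.filter fun c' : C => c < c' ∧ S.marker c' = -1).card

variable (D)

/-- The free abelian group spanned by the enhanced states. -/
abbrev Chain : Type _ := D.EnhancedState →₀ ℤ

/-- The part of bidegree `(i, j)`, spanned by the enhanced states with `σ = i`, `σ + 2 τ = j`. -/
noncomputable def chainDeg (i j : ℤ) : Submodule ℤ D.Chain :=
  Finsupp.supported ℤ ℤ {S : D.EnhancedState | S.sigma = i ∧ S.deg = j}

open Classical in
/-- The differential `d S = ∑ (-1)^t(S : S') [S : S'] S'`; it maps bidegree `(i, j)` to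
`(i - 2, j)`. -/
noncomputable def differential : D.Chain →ₗ[ℤ] D.Chain :=
  Finsupp.linearCombination ℤ fun S : D.EnhancedState =>
    ∑ S' : D.EnhancedState, ∑ c : C,
      if Incident c S S' then Finsupp.single S' ((-1 : ℤ) ^ negAbove c S) else 0

/-- The cycles of bidegree `(i, j)`. -/
noncomputable def cycles (i j : ℤ) : Submodule ℤ D.Chain :=
  LinearMap.ker D.differential ⊓ D.chainDeg i j

/-- The boundaries of bidegree `(i, j)`: the image of the chains of bidegree `(i + 2, j)`. -/
noncomputable def boundaries (i j : ℤ) : Submodule ℤ D.Chain :=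
  (D.chainDeg (i + 2) j).map D.differential

/-- The Khovanov homology group `H_{i,j}(D)`: cycles modulo boundaries. -/
abbrev KhovanovHomology (i j : ℤ) : Type _ :=
  ↥(D.cycles i j) ⧸ (D.boundaries i j).submoduleOf (D.cycles i j)

/-- `N - 2|s₋| - 4 k₂ ≤ j - 2 i ≤ 2|s₊| - N + 4 k₁`. -/
def InBand (k₁ k₂ i j : ℤ) : Prop :=
  (Fintype.card C : ℤ) - 2 * (D.numCircles (negState C) : ℤ) - 4 * k₂ ≤ j - 2 * i ∧
    j - 2 * i ≤ 2 * (D.numCircles (posState C) : ℤ) - (Fintype.card C : ℤ) + 4 * k₁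

/-- `H`-`(k₁, k₂)`-thick: the Khovanov homology vanishes outside the band. -/
def IsHThick (k₁ k₂ : ℤ) : Prop :=
  ∀ i j : ℤ, ¬ D.InBand k₁ k₂ i j → Subsingleton (D.KhovanovHomology i j)

/-- `TH`-`(k₁, k₂)`-thick: the torsion of the Khovanov homology vanishes outside the band. -/
def IsTHThick (k₁ k₂ : ℤ) : Prop :=
  ∀ i j : ℤ, ¬ D.InBand k₁ k₂ i j → Submodule.torsion ℤ (D.KhovanovHomology i j) = ⊥

end Complex

end LinkDiagram

/-! The complex is a cube of tensor powers of Z[X]/(X²): a negative circle carries 1, a positive one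
carries X, and `raise x` multiplies by X on the circle through x. Fix a base dart b. The reduced
chains are the kernel of `raise b`, that is, the chains with X on the circle through b.

The core is `thinBetween_reducedOff`: for a connected diagram with some crossings already smoothed,
the reduced homology lives only on the diagonals j - 2i spanned by the values 2 - `markerSum t`,
where t runs over the states with a single circle; if these values lie in [lo, hi], the homology is
also torsion-free for j - 2i < lo + 4. The proof is by induction on the unsmoothed crossings. By
connectedness some unsmoothed crossing c is met by the circle through b in every remaining state
(`IsConnectedOff.exists_circleOf_eq`). The complex is the cone of the edge map at c between the two
smoothings of c.

If both smoothings are connected, the cone inherits the bounds. Torsion-freeness passes too, because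
the obstruction lies on the diagonal j - 2i - 4 < lo, where the homology is zero. If one smoothing
is disconnected, c merges two circles in all its states and splits one in all states of the other
smoothing (`joined_flipAt`, the place where planarity enters the algebra). On reduced chains the
edge map is then locally the merge of X ⊗ Z[X]/(X²) onto X, or the split of X into X ⊗ X, and the
cone has the homology of the connected smoothing, shifted by (2, 4) or its inverse, which preserves
j - 2i. With no crossings left there is one circle, carrying X: a copy of Z on the diagonal 2 -
`markerSum`.

Multiplication by X at b exhibits the full complex as an extension of two copies of the reduced one,
whose diagonals differ by 4, so the bounds become [lo - 4, hi] with no torsion below lo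
(`thinBetween_chainsOff`).

The values lo and hi come from counting circles (`IsAlmostAlternating.bounds`). The two extreme
states of the alternating diagram have at least as many circles together as there are faces, hence
at least N + 2. A marker change alters the number of circles by one. So a single-circle state sits
at the least distance that these counts allow from each extreme state, and k crossing changes move
each estimate by at most 4k. -/

namespace FourValentMap

/-! ### Planarity: the mod 2 cellular complex and the checkerboard colouring. -/

variable {C : Type*} (G : FourValentMap C)

instance [Finite C] : Finite G.Edge := by unfold Edge; infer_instance
instance [Finite C] : Finite G.Face := by unfold Face; infer_instance
instance [Finite C] : Finite G.Component := by unfold Component; infer_instance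

/-- The edge that contains the dart `x`. -/
def edgeOf (x : Dart C) : G.Edge := Quot.mk _ x

/-- The component that contains the vertex `c`. -/
def componentOf (c : C) : G.Component := Quot.mk _ c

theorem edgeOf_glue (x : Dart C) : G.edgeOf (G.glue x) = G.edgeOf x :=
  (Quot.sound rfl : G.edgeOf x = G.edgeOf (G.glue x)).symm

theorem edgeOf_eq_iff (x y : Dart C) : G.edgeOf x = G.edgeOf y ↔ y = x ∨ y = G.glue x := by
  constructor
  · intro h
    have := Quot.eqvGen_exact h
    clear h
    induction this with
    | rel x y h => exact Or.inr h
    | refl x => exact Or.inl rfl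
    | symm x y _ ih =>
      rcases ih with h | h
      · exact Or.inl h.symm
      · right; rw [h, G.glue_glue]
    | trans x y z _ _ ih1 ih2 =>
      rcases ih1 with h | h <;> rcases ih2 with h' | h' <;> simp [h, h', G.glue_glue]
  · rintro (rfl | rfl)
    · rfl
    · exact (G.edgeOf_glue x).symm

theorem faceOf_faceNext (x : Dart C) : G.faceOf (G.faceNext x) = G.faceOf x :=
  (Quot.sound rfl : G.faceOf x = G.faceOf (G.faceNext x)).symm

theorem faceOf_glue (x : Dart C) : G.faceOf (G.glue x) = G.faceOf (x.1, x.2 - 1) := by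
  rw [← G.faceOf_faceNext (G.glue x), faceNext, G.glue_glue]

/-- The coboundary of a function on the faces: its jump across each edge. -/
def faceCoboundary : (G.Face → ZMod 2) →ₗ[ZMod 2] (G.Edge → ZMod 2) where
  toFun g e := Quot.lift (fun x => g (G.faceOf x) + g (G.faceOf (G.glue x)))
    (by rintro x _ rfl; rw [G.glue_glue, add_comm]) e
  map_add' g h := by
    ext e
    induction e using Quot.ind
    exact add_add_add_comm _ _ _ _
  map_smul' r g := by
    ext e
    induction e using Quot.ind
    exact (mul_add _ _ _).symm

theorem faceCoboundary_edgeOf (g : G.Face → ZMod 2) (x : Dart C) :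
    G.faceCoboundary g (G.edgeOf x) = g (G.faceOf x) + g (G.faceOf (G.glue x)) := rfl

/-- The sum of a function on the edges over the four darts at each vertex. -/
def vertexSum : (G.Edge → ZMod 2) →ₗ[ZMod 2] (C → ZMod 2) where
  toFun h c := ∑ a : ZMod 4, h (G.edgeOf (c, a))
  map_add' g h := by ext c; simp [Finset.sum_add_distrib]
  map_smul' r g := by ext c; simp [Finset.mul_sum]

theorem vertexSum_apply (h : G.Edge → ZMod 2) (c : C) :
    G.vertexSum h c = ∑ a : ZMod 4, h (G.edgeOf (c, a)) := rfl

/-- The edge of the dart (c, a) borders the corners a and a - 1, so each of the four corners at c is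
counted twice. -/
theorem vertexSum_faceCoboundary (g : G.Face → ZMod 2) :
    G.vertexSum (G.faceCoboundary g) = 0 := by
  ext c
  simp only [vertexSum_apply, faceCoboundary_edgeOf, faceOf_glue, Finset.sum_add_distrib,
    Pi.zero_apply]
  rw [← Equiv.sum_comp (Equiv.subRight (1 : ZMod 4)) (fun a => g (G.faceOf (c, a)))]
  simp only [Equiv.subRight_apply]
  exact CharTwo.add_self_eq_zero _

theorem vertexSum_single [DecidableEq C] [DecidableEq G.Edge] (x : Dart C) :
    G.vertexSum (Pi.single (G.edgeOf x) 1) = Pi.single x.1 1 + Pi.single (G.glue x).1 1 := by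
  ext c
  have key : ∀ a : ZMod 4, (Pi.single (G.edgeOf x) 1 : G.Edge → ZMod 2) (G.edgeOf (c, a)) =
      (if (c, a) = x then 1 else 0) + if (c, a) = G.glue x then 1 else 0 := by
    intro a
    have hx := G.glue_ne x
    have hiff := G.edgeOf_eq_iff x (c, a)
    rw [eq_comm] at hiff
    by_cases h1 : (c, a) = x
    · subst h1; simp [hx.symm]
    · simp [Pi.single_apply, hiff, h1]
  have key2 : ∀ y : Dart C, (∑ a : ZMod 4, if (c, a) = y then (1 : ZMod 2) else 0) =
      (Pi.single y.1 1 : C → ZMod 2) c := by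
    intro y
    rw [Pi.single_apply]
    by_cases h : c = y.1
    · subst h; simp [Prod.ext_iff]
    · simp [Prod.ext_iff, h]
  simp only [vertexSum_apply, key, Finset.sum_add_distrib, key2, Pi.add_apply]

variable [Finite C]

/-- A function without jumps takes the same value on all corners at a vertex and at both ends of an
edge, so it comes from a function on the components. -/
theorem finrank_ker_faceCoboundary_le :
    Module.finrank (ZMod 2) (LinearMap.ker G.faceCoboundary) ≤ Nat.card G.Component := by
  classical
  have := Fintype.ofFinite C
  have := Fintype.ofFinite G.Component
  have := Fintype.ofFinite G.Face
  let PF : (G.Face → ZMod 2) →ₗ[ZMod 2] (Dart C → ZMod 2) := LinearMap.funLeft _ _ G.faceOf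
  let PC : (G.Component → ZMod 2) →ₗ[ZMod 2] (Dart C → ZMod 2) :=
    LinearMap.funLeft _ _ fun x => G.componentOf x.1
  have hPF : Function.Injective PF :=
    LinearMap.funLeft_injective_of_surjective _ _ _ Quot.mk_surjective
  have hle : (LinearMap.ker G.faceCoboundary).map PF ≤ LinearMap.range PC := by
    rintro _ ⟨g, hg, rfl⟩
    have hg1 : ∀ x, g (G.faceOf (G.glue x)) = g (G.faceOf x) := fun x =>
      (CharTwo.add_eq_zero.1 (congrFun hg (G.edgeOf x))).symm
    have hg2 : ∀ c (a : ZMod 4), g (G.faceOf (c, a)) = g (G.faceOf (c, 0)) := by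
      have step : ∀ c (a : ZMod 4), g (G.faceOf (c, a)) = g (G.faceOf (c, a - 1)) := fun c a => by
        rw [← hg1 (c, a), G.faceOf_glue]
      intro c a
      have h1 := step c 1
      have h2 := step c 2
      have h3 := step c 3
      rw [show (1 : ZMod 4) - 1 = 0 from rfl] at h1
      rw [show (2 : ZMod 4) - 1 = 1 from rfl] at h2
      rw [show (3 : ZMod 4) - 1 = 2 from rfl] at h3
      fin_cases a
      · rfl
      · exact h1
      · exact h2.trans h1
      · exact h3.trans (h2.trans h1)
    refine ⟨Quot.lift (fun c => g (G.faceOf (c, 0))) ?_, ?_⟩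
    · rintro c c' ⟨a, b, h⟩
      have := hg1 (c, a)
      rw [h] at this
      rw [← hg2 c a, ← this, hg2]
    · ext x
      exact (hg2 x.1 x.2).symm
  calc Module.finrank (ZMod 2) (LinearMap.ker G.faceCoboundary)
      = Module.finrank (ZMod 2) ((LinearMap.ker G.faceCoboundary).map PF) :=
        LinearEquiv.finrank_eq (Submodule.equivMapOfInjective PF hPF _)
    _ ≤ Module.finrank (ZMod 2) (LinearMap.range PC) := Submodule.finrank_mono hle
    _ ≤ Module.finrank (ZMod 2) (G.Component → ZMod 2) := LinearMap.finrank_range_le _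
    _ = Nat.card G.Component := by
      rw [Module.finrank_fintype_fun_eq_card, Nat.card_eq_fintype_card]

/-- An edge contributes the sum of the indicators of its two ends. Modulo such sums every vertex
equals the chosen representative of its component, so one generator per component fills the
cokernel. -/
theorem card_le_finrank_range_vertexSum_add :
    Nat.card C ≤ Module.finrank (ZMod 2) (LinearMap.range G.vertexSum) +
      Nat.card G.Component := by
  classical
  have := Fintype.ofFinite C
  have := Fintype.ofFinite G.Component
  have htwo : ∀ g : C → ZMod 2, g + g = 0 := fun g => by
    ext c; exact CharTwo.add_self_eq_zero _
  let J : (G.Component → ZMod 2) →ₗ[ZMod 2] (C → ZMod 2) :=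
    Fintype.linearCombination (ZMod 2) fun k : G.Component => (Pi.single (Quot.out k) 1 : C → ZMod 2)
  have hJ : ∀ k : G.Component, (Pi.single (Quot.out k) 1 : C → ZMod 2) ∈ LinearMap.range J :=
    fun k => ⟨Pi.single k 1, by simp [J, Fintype.linearCombination_apply_single]⟩
  have hrel : ∀ u v, Relation.EqvGen (fun c c' : C => ∃ a b : ZMod 4, G.glue (c, a) = (c', b)) u v →
      (Pi.single u 1 + Pi.single v 1 : C → ZMod 2) ∈ LinearMap.range G.vertexSum := by
    intro u v h
    induction h with
    | rel u v h =>
      obtain ⟨a, b, h⟩ := h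
      exact ⟨_, by rw [G.vertexSum_single (u, a), h]⟩
    | refl u => rw [htwo]; exact zero_mem _
    | symm u v _ ih => rwa [add_comm]
    | trans u v w _ _ ih1 ih2 =>
      have := add_mem ih1 ih2
      rwa [add_assoc, ← add_assoc (Pi.single v 1), htwo, zero_add] at this
  have htop : LinearMap.range G.vertexSum ⊔ LinearMap.range J = ⊤ := by
    rw [eq_top_iff, ← (Pi.basisFun (ZMod 2) C).span_eq, Submodule.span_le]
    rintro _ ⟨v, rfl⟩
    rw [Pi.basisFun_apply]
    have h := hrel v (Quot.out (G.componentOf v))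
      (Quot.eqvGen_exact (Quot.out_eq (G.componentOf v)).symm)
    have h2 := Submodule.add_mem_sup h (hJ (G.componentOf v))
    rwa [add_assoc, htwo, add_zero] at h2
  calc Nat.card C = Module.finrank (ZMod 2) (C → ZMod 2) := by
        rw [Module.finrank_fintype_fun_eq_card, Nat.card_eq_fintype_card]
    _ = Module.finrank (ZMod 2) ↥(LinearMap.range G.vertexSum ⊔ LinearMap.range J) := by
        rw [htop, finrank_top]
    _ ≤ _ := Submodule.finrank_add_le_finrank_add_finrank _ _
    _ ≤ _ := by
        gcongr
        refine (LinearMap.finrank_range_le J).trans_eq ?_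
        rw [Module.finrank_fintype_fun_eq_card, Nat.card_eq_fintype_card]

/-- The darts of a planar four-valent map have a two-colouring that alternates around each vertex
and along each edge. -/
theorem IsPlanar.exists_coloring {G : FourValentMap C} (hG : G.IsPlanar) :
    ∃ f : Dart C → ZMod 2, (∀ x, f (G.glue x) = f x + 1) ∧
      ∀ c a, f (c, a + 1) = f (c, a) + 1 := by
  classical
  have := Fintype.ofFinite C
  have := Fintype.ofFinite G.Component
  have := Fintype.ofFinite G.Face
  have := Fintype.ofFinite G.Edge
  have h0 := LinearMap.finrank_range_add_finrank_ker G.faceCoboundary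
  have h1 := LinearMap.finrank_range_add_finrank_ker G.vertexSum
  rw [Module.finrank_fintype_fun_eq_card, ← Nat.card_eq_fintype_card] at h0 h1
  have h2 := G.finrank_ker_faceCoboundary_le
  have h3 := G.card_le_finrank_range_vertexSum_add
  have hle : LinearMap.range G.faceCoboundary ≤ LinearMap.ker G.vertexSum := by
    rintro _ ⟨g, rfl⟩
    exact G.vertexSum_faceCoboundary g
  -- The rank of the coboundary is at least F minus the number of components, the kernel of the
  -- vertex sum has dimension at most E - V plus that number, and Euler's formula makes the two
  -- equal: the first cohomology vanishes.
  have heq := Submodule.eq_of_le_of_finrank_le hle (by unfold IsPlanar at hG; omega)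
  -- Four darts per vertex make the constant 1 a cocycle; a primitive of it is a checkerboard
  -- colouring of the faces.
  have hone : (fun _ => 1 : G.Edge → ZMod 2) ∈ LinearMap.range G.faceCoboundary := by
    rw [heq, LinearMap.mem_ker]
    ext c
    simp only [vertexSum_apply, Finset.sum_const, Finset.card_univ, ZMod.card]
    rfl
  obtain ⟨g, hg⟩ := hone
  have hglue : ∀ x, g (G.faceOf (G.glue x)) = g (G.faceOf x) + 1 := fun x => by
    have := congrFun hg (G.edgeOf x)
    rw [faceCoboundary_edgeOf] at this
    rw [← this, ← add_assoc, CharTwo.add_self_eq_zero, zero_add]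
  refine ⟨fun x => g (G.faceOf x), hglue, fun c a => ?_⟩
  have := hglue (c, a + 1)
  rw [faceOf_glue, add_sub_cancel_right] at this
  change g (G.faceOf (c, a + 1)) = g (G.faceOf (c, a)) + 1
  rw [show g (G.faceOf (c, a)) = _ from this, add_assoc, CharTwo.add_self_eq_zero, add_zero]

end FourValentMap

/-! ### Cycles of a permutation multiplied by a transposition. -/

theorem Equiv.Perm.sameCycle_swap_mul_iff {α : Type*} [Finite α] [DecidableEq α]
    (ρ : Equiv.Perm α) {p q : α} (hpq : p ≠ q) :
    (Equiv.swap p q * ρ).SameCycle p q ↔ ¬ ρ.SameCycle p q := by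
  classical
  set τ := Equiv.swap p q * ρ with hτ
  have hex : ∃ m, 0 < m ∧ ((ρ ^ m) p = p ∨ (ρ ^ m) p = q) :=
    ⟨orderOf ρ, orderOf_pos ρ, Or.inl (by simp [pow_orderOf_eq_one])⟩
  -- m is the first return time of p to {p, q} under ρ. The orbits of p under ρ and τ agree before
  -- time m; at time m one of them is at p and the other at q. The one at p has closed up without
  -- meeting q.
  set m := Nat.find hex with hm
  obtain ⟨hm0, hm1⟩ := Nat.find_spec hex
  have hmin : ∀ k, 0 < k → k < m → (ρ ^ k) p ≠ p ∧ (ρ ^ k) p ≠ q := fun k h0 h =>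
    not_or.1 fun h' => Nat.find_min hex h ⟨h0, h'⟩
  have hpow : ∀ k, k < m → (τ ^ k) p = (ρ ^ k) p := by
    intro k
    induction k with
    | zero => simp
    | succ k ih =>
      intro h
      obtain ⟨h1, h2⟩ := hmin (k + 1) k.succ_pos h
      rw [pow_succ', Equiv.Perm.mul_apply, ih (by omega), hτ, Equiv.Perm.mul_apply,
        ← Equiv.Perm.mul_apply ρ, ← pow_succ', Equiv.swap_apply_of_ne_of_ne h1 h2]
  have hτm : (τ ^ m) p = Equiv.swap p q ((ρ ^ m) p) := by
    obtain ⟨k, hk⟩ : ∃ k, m = k + 1 := ⟨m - 1, by omega⟩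
    rw [hk, pow_succ', Equiv.Perm.mul_apply, hpow k (by omega), hτ, Equiv.Perm.mul_apply,
      ← Equiv.Perm.mul_apply ρ, ← pow_succ']
  have hcycle : ∀ κ : Equiv.Perm α, (∀ k, k < m → (κ ^ k) p = (ρ ^ k) p) → (κ ^ m) p = p →
      ¬ κ.SameCycle p q := by
    intro κ h1 h2 h3
    obtain ⟨n, hn⟩ := h3.exists_nat_pow_eq
    have h4 : (κ ^ n) p = (κ ^ (n % m)) p := by
      conv_lhs => rw [← Nat.mod_add_div n m, pow_add, Equiv.Perm.mul_apply, pow_mul]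
      rw [Equiv.Perm.pow_apply_eq_self_of_apply_eq_self h2]
    rw [h4, h1 _ (Nat.mod_lt _ hm0)] at hn
    rcases Nat.eq_zero_or_pos (n % m) with h5 | h5
    · rw [h5] at hn; exact hpq hn
    · exact (hmin _ h5 (Nat.mod_lt _ hm0)).2 hn
  rcases hm1 with h | h
  · rw [h, Equiv.swap_apply_left] at hτm
    exact iff_of_true ⟨m, by exact_mod_cast hτm⟩ (hcycle ρ (fun _ _ => rfl) h)
  · rw [h, Equiv.swap_apply_right] at hτm
    exact iff_of_false (hcycle τ hpow hτm) (not_not.2 ⟨m, by exact_mod_cast h⟩)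

/-! ### Circles of a state, and what a change of marker does to them. -/

namespace LinkDiagram

/-- The state with the marker at `c` changed. -/
def flipAt {C : Type*} [DecidableEq C] (c : C) (t : State C) : State C :=
  Function.update t c (-t c)

section Flip

variable {C : Type*} [DecidableEq C]

@[simp] theorem flipAt_self (c : C) (t : State C) : flipAt c t c = -t c := by simp [flipAt]

theorem flipAt_of_ne {c c' : C} (h : c' ≠ c) (t : State C) : flipAt c t c' = t c' := by
  simp [flipAt, h]

@[simp] theorem flipAt_flipAt (c : C) (t : State C) : flipAt c (flipAt c t) = t := by
  ext c'
  by_cases h : c' = c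
  · subst h; simp
  · simp [flipAt_of_ne h]

theorem flipAt_comm (c c' : C) (t : State C) :
    flipAt c (flipAt c' t) = flipAt c' (flipAt c t) := by
  by_cases h : c = c'
  · rw [h]
  ext d
  by_cases h1 : d = c
  · subst h1; simp [flipAt_of_ne h]
  · by_cases h2 : d = c'
    · subst h2; simp [flipAt_of_ne h1]
    · simp [flipAt_of_ne h1, flipAt_of_ne h2]

end Flip

variable {C : Type*} (D : LinkDiagram C)

theorem isOver_add_two (c : C) (a : ZMod 4) : D.isOver (c, a + 2) = D.isOver (c, a) := by
  rw [show a + 2 = a + 1 + 1 by ring, D.isOver_next, D.isOver_next, Bool.not_not]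

theorem isOver_sub_one (c : C) (a : ZMod 4) : D.isOver (c, a - 1) = !D.isOver (c, a) := by
  have := D.isOver_next c (a - 1)
  rw [sub_add_cancel] at this
  rw [this, Bool.not_not]

/-- The smoothing at a crossing connects each dart to one of its two neighbours, and the opposite
dart to the opposite neighbour. -/
theorem arc_cases (t : State C) (c : C) (a : ZMod 4) :
    (D.arc t (c, a) = (c, a + 1) ∧ D.arc t (c, a + 1) = (c, a) ∧
      D.arc t (c, a + 2) = (c, a + 3)) ∨
    (D.arc t (c, a) = (c, a - 1) ∧ D.arc t (c, a - 1) = (c, a) ∧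
      D.arc t (c, a + 2) = (c, a + 1)) := by
  have h2 : a + 2 - 1 = a + 1 := by ring
  have h3 : a + 2 + 1 = a + 3 := by ring
  have h4 : a + 2 + -1 = a + 1 := by ring
  rcases Int.units_eq_one_or (t c) with h | h <;> cases hO : D.isOver (c, a) <;>
    simp [arc, h, hO, isOver_add_two, isOver_next, isOver_sub_one, h2, h3, h4, ← sub_eq_add_neg]

theorem arc_arc (t : State C) (x : Dart C) : D.arc t (D.arc t x) = x := by
  rcases D.arc_cases t x.1 x.2 with ⟨h1, h2, -⟩ | ⟨h1, h2, -⟩ <;>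
    exact (congrArg _ h1).trans h2

theorem arc_congr {t t' : State C} {x : Dart C} (h : t' x.1 = t x.1) : D.arc t' x = D.arc t x := by
  simp [arc, h]

theorem circleOf_glue (t : State C) (x : Dart C) : D.circleOf t (D.glue x) = D.circleOf t x :=
  (congrArg Sum.inl (Quot.sound (Or.inl rfl)) : D.circleOf t x = D.circleOf t (D.glue x)).symm

theorem circleOf_arc (t : State C) (x : Dart C) : D.circleOf t (D.arc t x) = D.circleOf t x :=
  (congrArg Sum.inl (Quot.sound (Or.inr rfl)) : D.circleOf t x = D.circleOf t (D.arc t x)).symm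

/-- The circles form the finest partition of the darts that is compatible with the edges and the
smoothings. -/
theorem rel_of_circleOf_eq {t : State C} (r : Setoid (Dart C)) (hglue : ∀ x, r x (D.glue x))
    (harc : ∀ x, r x (D.arc t x)) {x y : Dart C} (h : D.circleOf t x = D.circleOf t y) : r x y := by
  have := Quot.eqvGen_exact (Sum.inl_injective h)
  clear h
  induction this with
  | rel x y h =>
    rcases h with rfl | rfl
    · exact hglue x
    · exact harc x
  | refl x => exact r.refl x
  | symm x y _ ih => exact r.symm ih
  | trans x y z _ _ ih1 ih2 => exact r.trans ih1 ih2

/-- A single circle passes through the crossing `c` twice. -/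
def Joined (t : State C) (c : C) : Prop := D.circleOf t (c, 0) = D.circleOf t (c, 2)

/-- The circle of the dart `x` passes through the crossing `c`. -/
def Touches (t : State C) (c : C) (x : Dart C) : Prop :=
  ∃ a : ZMod 4, D.circleOf t (c, a) = D.circleOf t x

theorem circleOf_add (t : State C) (c : C) (a : ZMod 4) :
    (D.circleOf t (c, a + 1) = D.circleOf t (c, a) ∧
      D.circleOf t (c, a + 3) = D.circleOf t (c, a + 2)) ∨
    (D.circleOf t (c, a + 1) = D.circleOf t (c, a + 2) ∧
      D.circleOf t (c, a + 3) = D.circleOf t (c, a)) := by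
  have h0 := D.circleOf_arc t (c, a)
  have h2 := D.circleOf_arc t (c, a + 2)
  rcases D.arc_cases t c a with ⟨h, -, h'⟩ | ⟨h, -, h'⟩
  · rw [h] at h0; rw [h'] at h2
    exact Or.inl ⟨h0, h2⟩
  · rw [h, show a - 1 = a + 3 by rw [sub_eq_add_neg]; rfl] at h0; rw [h'] at h2
    exact Or.inr ⟨h2, h0⟩

/-- The unordered pair of the circles of opposite darts at a crossing. -/
theorem circleOf_opposite (t : State C) (c : C) (a : ZMod 4) :
    (D.circleOf t (c, a) = D.circleOf t (c, 0) ∧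
      D.circleOf t (c, a + 2) = D.circleOf t (c, 2)) ∨
    (D.circleOf t (c, a) = D.circleOf t (c, 2) ∧
      D.circleOf t (c, a + 2) = D.circleOf t (c, 0)) := by
  have h := D.circleOf_add t c 0
  simp only [zero_add] at h
  fin_cases a
  · exact Or.inl ⟨rfl, rfl⟩
  · exact h
  · exact Or.inr ⟨rfl, rfl⟩
  · exact h.symm.imp And.symm And.symm

theorem joined_iff (t : State C) (c : C) (a : ZMod 4) :
    D.Joined t c ↔ D.circleOf t (c, a) = D.circleOf t (c, a + 2) := by
  unfold Joined
  rcases D.circleOf_opposite t c a with ⟨h1, h2⟩ | ⟨h1, h2⟩ <;> rw [h1, h2]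
  exact eq_comm

theorem touches_iff (t : State C) (c : C) (x : Dart C) :
    D.Touches t c x ↔ D.circleOf t x = D.circleOf t (c, 0) ∨
      D.circleOf t x = D.circleOf t (c, 2) := by
  constructor
  · rintro ⟨a, ha⟩
    rw [← ha]
    exact (D.circleOf_opposite t c a).imp And.left And.left
  · rintro (h | h)
    exacts [⟨0, h.symm⟩, ⟨2, h.symm⟩]

theorem touches_self (t : State C) (c : C) (a : ZMod 4) : D.Touches t c (c, a) := ⟨a, rfl⟩

theorem Touches.congr {D : LinkDiagram C} {t : State C} {c : C} {x y : Dart C}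
    (h : D.Touches t c x) (hxy : D.circleOf t x = D.circleOf t y) : D.Touches t c y :=
  h.imp fun _ h => h.trans hxy

/-- The step along a circle that consists of an edge and a smoothing arc, as a permutation of the
darts of one colour. -/
def circleStep (f : Dart C → ZMod 2) (hg : ∀ x, f (D.glue x) = f x + 1)
    (ha : ∀ c a, f (c, a + 1) = f (c, a) + 1) (κ : ZMod 2) (t : State C) :
    Equiv.Perm {x // f x = κ} :=
  have hadd : ∀ k : ZMod 2, k + 1 + 1 = k := by decide
  have harc : ∀ x, f (D.arc t x) = f x + 1 := fun x => by
    rcases D.arc_cases t x.1 x.2 with ⟨h, -⟩ | ⟨h, -⟩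
    · rw [show D.arc t x = _ from h, ha]
    · rw [show D.arc t x = _ from h, ← hadd (f (x.1, x.2 - 1)), ← ha, sub_add_cancel]
  { toFun := fun x => ⟨D.arc t (D.glue x), by rw [harc, hg, hadd, x.2]⟩
    invFun := fun x => ⟨D.glue (D.arc t x), by rw [hg, harc, hadd, x.2]⟩
    left_inv := fun x => by simp [arc_arc, D.glue_glue]
    right_inv := fun x => by simp [arc_arc, D.glue_glue] }

/-- Colours alternate along a circle, so the darts of one colour orient it and the step runs around
it once. For the converse, the cycle relation is extended to all darts through `rep`, which replaces
a dart of the other colour by the far end of its edge; the circles are the finest partition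
compatible with edges and arcs. -/
theorem sameCycle_circleStep_iff (f : Dart C → ZMod 2) (hg : ∀ x, f (D.glue x) = f x + 1)
    (ha : ∀ c a, f (c, a + 1) = f (c, a) + 1) (κ : ZMod 2) (t : State C)
    (x y : {x // f x = κ}) :
    (D.circleStep f hg ha κ t).SameCycle x y ↔ D.circleOf t x = D.circleOf t y := by
  have hadd : ∀ k : ZMod 2, k + 1 + 1 = k := by decide
  have harc : ∀ x, f (D.arc t x) = f x + 1 := fun x => by
    rcases D.arc_cases t x.1 x.2 with ⟨h, -⟩ | ⟨h, -⟩
    · rw [show D.arc t x = _ from h, ha]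
    · rw [show D.arc t x = _ from h, ← hadd (f (x.1, x.2 - 1)), ← ha, sub_add_cancel]
  set ρ := D.circleStep f hg ha κ t with hρ
  have hρv : ∀ x, (ρ x : Dart C) = D.arc t (D.glue x) := fun _ => rfl
  constructor
  · rintro ⟨n, rfl⟩
    have hstep : ∀ x, D.circleOf t (ρ x) = D.circleOf t x := fun x => by
      rw [hρv, D.circleOf_arc, D.circleOf_glue]
    induction n with
    | zero => rfl
    | succ n ih => rw [add_comm, zpow_add, zpow_one, Equiv.Perm.mul_apply, hstep, ih]
    | pred n ih =>
      rw [ih, ← hstep ((ρ ^ (-(n : ℤ) - 1)) x), ← Equiv.Perm.mul_apply, ← zpow_one_add]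
      congr 4; ring
  · intro h
    have hne : ∀ k : ZMod 2, k ≠ κ → k + 1 = κ := by
      generalize κ = κ'; revert κ'; decide
    have hne' : ∀ k : ZMod 2, k = κ → k + 1 ≠ κ := by
      generalize κ = κ'; revert κ'; decide
    let rep : Dart C → {x // f x = κ} := fun x =>
      if hx : f x = κ then ⟨x, hx⟩ else ⟨D.glue x, by rw [hg]; exact hne _ hx⟩
    have hrep : ∀ x : {x // f x = κ}, rep x = x := fun x => by simp [rep, x.2]
    let r : Setoid (Dart C) := (Equiv.Perm.SameCycle.setoid ρ).comap rep
    have hr : ∀ x y, r x y ↔ ρ.SameCycle (rep x) (rep y) := fun _ _ => Iff.rfl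
    have key : r (x : Dart C) (y : Dart C) := by
      refine D.rel_of_circleOf_eq r (fun x => ?_) (fun x => ?_) h
      · rw [hr]
        have : rep (D.glue x) = rep x := by
          by_cases hx : f x = κ
          · have : f (D.glue x) ≠ κ := by rw [hg]; exact hne' _ hx
            simp [rep, hx, this, D.glue_glue]
          · have : f (D.glue x) = κ := by rw [hg]; exact hne _ hx
            simp [rep, hx, this]
        rw [this]
      · rw [hr]
        by_cases hx : f x = κ
        · have h1 : f (D.arc t x) ≠ κ := by rw [harc]; exact hne' _ hx
          refine Equiv.Perm.SameCycle.symm ⟨1, Subtype.ext ?_⟩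
          simp [rep, hx, h1, hρv, D.glue_glue, arc_arc]
        · have h1 : f (D.arc t x) = κ := by rw [harc]; exact hne _ hx
          refine ⟨1, Subtype.ext ?_⟩
          simp [rep, hx, h1, hρv, D.glue_glue]
    rwa [hr, hrep, hrep] at key

variable [DecidableEq C]

/-- Only the arcs at c change, so uniting all old circles through c gives a partition that the new
edges and arcs respect. -/
theorem circleOf_flipAt {t : State C} {c : C} {x y : Dart C}
    (h : D.circleOf (flipAt c t) x = D.circleOf (flipAt c t) y) :
    D.circleOf t x = D.circleOf t y ∨ (D.Touches t c x ∧ D.Touches t c y) := by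
  refine D.rel_of_circleOf_eq
    ⟨fun x y => D.circleOf t x = D.circleOf t y ∨ (D.Touches t c x ∧ D.Touches t c y), ?_⟩
    (fun x => Or.inl (D.circleOf_glue t x).symm) (fun x => ?_) h
  · refine ⟨fun x => Or.inl rfl, fun {x y} h => h.imp Eq.symm And.symm, fun {x y z} h h' => ?_⟩
    rcases h with h | ⟨h1, h2⟩ <;> rcases h' with h' | ⟨h1', h2'⟩
    · exact Or.inl (h.trans h')
    · exact Or.inr ⟨h1'.congr h.symm, h2'⟩
    · exact Or.inr ⟨h1, h2.congr h'⟩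
    · exact Or.inr ⟨h1, h2'⟩
  · by_cases hx : x.1 = c
    · subst hx
      exact Or.inr ⟨D.touches_self t x.1 x.2, D.touches_self t x.1 _⟩
    · rw [D.arc_congr (flipAt_of_ne hx t)]
      exact Or.inl (D.circleOf_arc t x).symm

theorem Touches.flipAt {D : LinkDiagram C} {t : State C} {c : C} {x : Dart C}
    (h : D.Touches t c x) : D.Touches (flipAt c t) c x := by
  obtain ⟨a, h⟩ := h
  rw [← flipAt_flipAt c t] at h
  rcases D.circleOf_flipAt h with h | h
  · exact ⟨a, h⟩
  · exact h.2

theorem touches_flipAt (t : State C) (c : C) (x : Dart C) :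
    D.Touches (flipAt c t) c x ↔ D.Touches t c x :=
  ⟨fun h => by simpa using h.flipAt, fun h => h.flipAt⟩

theorem arc_flipAt_self (t : State C) (c : C) (a : ZMod 4) :
    D.arc (flipAt c t) (c, a) = (c, (D.arc t (c, a)).2 + 2) := by
  have h1 : a - 1 + 2 = a + 1 := by ring
  have h2 : a + 1 + 2 = a - 1 := by rw [add_assoc, sub_eq_add_neg]; rfl
  rcases Int.units_eq_one_or (t c) with h | h <;> cases hO : D.isOver (c, a) <;>
    simp [arc, h, hO, h1, h2, ← sub_eq_add_neg]

/-- Changing the marker at a crossing of a planar diagram splits one circle or merges two. -/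
theorem joined_flipAt [Finite C] (t : State C) (c : C) :
    D.Joined (flipAt c t) c ↔ ¬ D.Joined t c := by
  obtain ⟨f, hg, ha⟩ := D.planar.exists_coloring
  have hadd : ∀ k : ZMod 2, k + 1 + 1 = k := by decide
  have hf2 : f (c, 2) = f (c, 0) := by
    have h1 := ha c 0
    have h2 := ha c 1
    rw [show (1 : ZMod 4) + 1 = 2 from rfl] at h2
    rw [h2, ← zero_add (1 : ZMod 4), h1, hadd]
  let p : {x // f x = f (c, 0)} := ⟨(c, 0), rfl⟩
  let q : {x // f x = f (c, 0)} := ⟨(c, 2), hf2⟩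
  have hpq : p ≠ q := by
    intro h
    have := congrArg (fun x : {x // f x = f (c, 0)} => (x : Dart C).2) h
    exact absurd (show (0 : ZMod 4) = 2 from this) (by decide)
  -- The darts at c of the chosen colour are (c, 0) and (c, 2). By `arc_flipAt_self` the new marker
  -- exchanges them as endpoints of a step, which is a multiplication by the transposition.
  have hmul : D.circleStep f hg ha (f (c, 0)) (flipAt c t) =
      Equiv.swap p q * D.circleStep f hg ha (f (c, 0)) t := by
    ext1 x
    rw [Equiv.Perm.mul_apply]
    set y := D.circleStep f hg ha (f (c, 0)) t x with hy
    have hyv : (y : Dart C) = D.arc t (D.glue x) := rfl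
    have hfst : (y : Dart C).1 = (D.glue x).1 := rfl
    by_cases hc : (D.glue x).1 = c
    · have h1 : (D.circleStep f hg ha (f (c, 0)) (flipAt c t) x : Dart C) =
          (c, (y : Dart C).2 + 2) := by
        change D.arc (flipAt c t) (D.glue x) = _
        have : D.glue x = (c, (D.glue x).2) := Prod.ext hc rfl
        rw [hyv, this, D.arc_flipAt_self]
      have hy2 := y.2
      rw [show (y : Dart C) = (c, (y : Dart C).2) from Prod.ext (hfst.trans hc) rfl] at hy2
      have hya : (y : Dart C).2 = 0 ∨ (y : Dart C).2 = 2 := by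
        have h3 := ha c 0
        have h4 := ha c 2
        have h5 : ∀ k : ZMod 2, k + 1 ≠ k := by decide
        generalize (y : Dart C).2 = a at hy2
        fin_cases a
        · exact Or.inl rfl
        · rw [show f (c, 0 + 1) = f (c, 0) from hy2] at h3
          exact absurd h3.symm (h5 _)
        · exact Or.inr rfl
        · rw [show f (c, 2 + 1) = f (c, 0) from hy2, hf2] at h4
          exact absurd h4.symm (h5 _)
      rcases hya with hya | hya
      · have : y = p := Subtype.ext (Prod.ext (hfst.trans hc) hya)
        rw [this, Equiv.swap_apply_left]
        refine Subtype.ext (h1.trans ?_)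
        rw [hya]; rfl
      · have : y = q := Subtype.ext (Prod.ext (hfst.trans hc) hya)
        rw [this, Equiv.swap_apply_right]
        refine Subtype.ext (h1.trans ?_)
        rw [hya]; rfl
    · have hyne : ∀ z : {x // f x = f (c, 0)}, (z : Dart C).1 = c → y ≠ z := by
        rintro z hz rfl
        exact hc (hfst.symm.trans hz)
      rw [Equiv.swap_apply_of_ne_of_ne (hyne p rfl) (hyne q rfl)]
      exact Subtype.ext (D.arc_congr (flipAt_of_ne hc t))
  have h := Equiv.Perm.sameCycle_swap_mul_iff (D.circleStep f hg ha (f (c, 0)) t) hpq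
  rwa [← hmul, sameCycle_circleStep_iff, sameCycle_circleStep_iff] at h

end LinkDiagram

/-! ### Enhanced states: signs of circles under merging and splitting. -/

namespace LinkDiagram

variable {C : Type*} {D : LinkDiagram C}

theorem circleOf_surjective [IsEmpty (Fin D.loops)] (t : State C) :
    Function.Surjective (D.circleOf t) := by
  rintro (γ | l)
  · induction γ using Quot.ind
    exact ⟨_, rfl⟩
  · exact isEmptyElim l

namespace EnhancedState

/-- The sign of the circle through a dart. -/
def sg (S : D.EnhancedState) (x : Dart C) : ℤˣ := S.sign (D.circleOf S.marker x)

theorem sg_congr (S : D.EnhancedState) {x y : Dart C}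
    (h : D.circleOf S.marker x = D.circleOf S.marker y) : S.sg x = S.sg y := by
  rw [sg, sg, h]

theorem ext_sg [IsEmpty (Fin D.loops)] {S S' : D.EnhancedState} (hm : S.marker = S'.marker)
    (hs : ∀ x, S.sg x = S'.sg x) : S = S' := by
  obtain ⟨t, e⟩ := S
  obtain ⟨t', e'⟩ := S'
  obtain rfl : t = t' := hm
  congr 1
  ext1 γ
  obtain ⟨x, rfl⟩ := circleOf_surjective t γ
  exact hs x

/-- The enhanced state in which all circles are negative. -/
def allNeg (D : LinkDiagram C) (t : State C) : D.EnhancedState := ⟨t, fun _ => -1⟩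

@[simp] theorem allNeg_sg (t : State C) (x : Dart C) : (allNeg D t).sg x = -1 := rfl

open Classical in
/-- Change the sign of the circle through the dart `x` to `v`. -/
noncomputable def setSign (S : D.EnhancedState) (x : Dart C) (v : ℤˣ) : D.EnhancedState :=
  ⟨S.marker, Function.update S.sign (D.circleOf S.marker x) v⟩

@[simp] theorem setSign_marker (S : D.EnhancedState) (x : Dart C) (v : ℤˣ) :
    (S.setSign x v).marker = S.marker := rfl

open Classical in
theorem setSign_sg (S : D.EnhancedState) (x : Dart C) (v : ℤˣ) (y : Dart C) :
    (S.setSign x v).sg y =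
      if D.circleOf S.marker y = D.circleOf S.marker x then v else S.sg y := by
  simp only [sg, setSign, Function.update_apply]

@[simp] theorem setSign_sg_self (S : D.EnhancedState) (x : Dart C) (v : ℤˣ) :
    (S.setSign x v).sg x = v := by simp [setSign_sg]

theorem setSign_sg_of_eq (S : D.EnhancedState) {x y : Dart C} (v : ℤˣ)
    (h : D.circleOf S.marker y = D.circleOf S.marker x) : (S.setSign x v).sg y = v := by
  simp [setSign_sg, h]

theorem setSign_sg_of_ne (S : D.EnhancedState) {x y : Dart C} (v : ℤˣ)
    (h : D.circleOf S.marker y ≠ D.circleOf S.marker x) : (S.setSign x v).sg y = S.sg y := by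
  simp [setSign_sg, h]

theorem setSign_setSign (S : D.EnhancedState) (x : Dart C) (v w : ℤˣ) :
    (S.setSign x v).setSign x w = S.setSign x w := by
  classical
  have h := Function.update_idem (a := D.circleOf S.marker x) v w S.sign
  exact congrArg (EnhancedState.mk S.marker) h

theorem setSign_eq_self (S : D.EnhancedState) {x : Dart C} {v : ℤˣ} (h : S.sg x = v) :
    S.setSign x v = S := by
  subst h
  simp [setSign, sg]

theorem setSign_congr (S : D.EnhancedState) {x y : Dart C} (v : ℤˣ)
    (h : D.circleOf S.marker x = D.circleOf S.marker y) : S.setSign x v = S.setSign y v := by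
  simp [setSign, h]

theorem setSign_comm (S : D.EnhancedState) {x y : Dart C} (v w : ℤˣ)
    (h : D.circleOf S.marker x ≠ D.circleOf S.marker y) :
    (S.setSign x v).setSign y w = (S.setSign y w).setSign x v := by
  classical
  have h' := Function.update_comm h v w S.sign
  exact congrArg (EnhancedState.mk S.marker) h'

variable [Fintype C]

theorem setSign_tau (S : D.EnhancedState) (x : Dart C) (v : ℤˣ) :
    (S.setSign x v).tau = S.tau - S.sg x + v := by
  classical
  obtain ⟨t, e⟩ := S
  change ∑ γ : D.Circle t, ((Function.update e (D.circleOf t x) v γ : ℤˣ) : ℤ) =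
    ∑ γ : D.Circle t, (e γ : ℤ) - e (D.circleOf t x) + v
  have h1 := Finset.add_sum_erase Finset.univ (fun γ => (e γ : ℤ))
    (Finset.mem_univ (D.circleOf t x))
  have h2 := Finset.add_sum_erase Finset.univ
    (fun γ => ((Function.update e (D.circleOf t x) v γ : ℤˣ) : ℤ))
    (Finset.mem_univ (D.circleOf t x))
  have h3 : ∑ γ ∈ Finset.univ.erase (D.circleOf t x),
      ((Function.update e (D.circleOf t x) v γ : ℤˣ) : ℤ) =
      ∑ γ ∈ Finset.univ.erase (D.circleOf t x), (e γ : ℤ) := by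
    refine Finset.sum_congr rfl fun γ hγ => ?_
    rw [Function.update_of_ne (Finset.ne_of_mem_erase hγ)]
  rw [h3] at h2
  simp only [Function.update_self] at h2
  linarith

theorem setSign_sigma (S : D.EnhancedState) (x : Dart C) (v : ℤˣ) :
    (S.setSign x v).sigma = S.sigma := rfl

end EnhancedState

section Merge

theorem Joined.circleOf_eq {t : State C} {c : C} (hj : D.Joined t c) {x y : Dart C}
    (hx : D.Touches t c x) (hy : D.Touches t c y) : D.circleOf t x = D.circleOf t y := by
  rw [touches_iff, ← show _ = _ from hj, or_self] at hx hy
  exact hx.trans hy.symm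

variable [Fintype C] [DecidableEq C]

/-- Smoothing changes that merge circles coarsen the partition into circles. -/
theorem circleOf_flipAt_of_not_joined {t : State C} {c : C} (hj : ¬ D.Joined t c) {x y : Dart C}
    (h : D.circleOf t x = D.circleOf t y) :
    D.circleOf (flipAt c t) x = D.circleOf (flipAt c t) y := by
  have hj' := (D.joined_flipAt t c).2 hj
  rw [← flipAt_flipAt c t] at h
  rcases D.circleOf_flipAt h with h | ⟨h1, h2⟩
  · exact h
  · rw [touches_iff, ← show _ = _ from hj', or_self] at h1 h2
    exact h1.trans h2.symm

variable [IsEmpty (Fin D.loops)]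

/-- Circles away from c correspond bijectively, through a representative dart, and keep their signs;
only the two merged circles and the resulting one contribute to the difference. -/
theorem tau_of_merge {S S' : D.EnhancedState} {c : C} (hm : S'.marker = flipAt c S.marker)
    (hj : ¬ D.Joined S.marker c)
    (hoff : ∀ x, ¬ D.Touches S.marker c x → S'.sg x = S.sg x) :
    S'.tau = S.tau - S.sg (c, 0) - S.sg (c, 2) + S'.sg (c, 0) := by
  classical
  obtain ⟨t, e⟩ := S
  obtain ⟨t', e'⟩ := S'
  obtain rfl : t' = flipAt c t := hm
  have hj' := (D.joined_flipAt t c).2 hj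
  simp only at hj hoff
  have hQ : D.circleOf t (c, 2) ∈ Finset.univ.erase (D.circleOf t (c, 0)) :=
    Finset.mem_erase.2 ⟨fun h => hj h.symm, Finset.mem_univ _⟩
  have h1 := Finset.add_sum_erase Finset.univ (fun γ => (e γ : ℤ))
    (Finset.mem_univ (D.circleOf t (c, 0)))
  have h2 := Finset.add_sum_erase _ (fun γ => (e γ : ℤ)) hQ
  have h3 := Finset.add_sum_erase Finset.univ (fun γ => (e' γ : ℤ))
    (Finset.mem_univ (D.circleOf (flipAt c t) (c, 0)))
  have hrep := Function.surjInv_eq (circleOf_surjective (D := D) t)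
  set rep := Function.surjInv (circleOf_surjective (D := D) t)
  have hmem : ∀ γ, γ ∈ (Finset.univ.erase (D.circleOf t (c, 0))).erase (D.circleOf t (c, 2)) →
      ¬ D.Touches t c (rep γ) := by
    intro γ hγ h
    rw [Finset.mem_erase, Finset.mem_erase] at hγ
    rw [touches_iff, hrep] at h
    exact h.elim hγ.2.1 hγ.1
  have h4 : ∑ γ ∈ (Finset.univ.erase (D.circleOf t (c, 0))).erase (D.circleOf t (c, 2)),
      (e γ : ℤ) = ∑ γ ∈ Finset.univ.erase (D.circleOf (flipAt c t) (c, 0)), (e' γ : ℤ) := by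
    refine Finset.sum_bij (fun γ _ => D.circleOf (flipAt c t) (rep γ)) ?_ ?_ ?_ ?_
    · intro γ hγ
      refine Finset.mem_erase.2 ⟨fun h => hmem γ hγ ?_, Finset.mem_univ _⟩
      rw [← touches_flipAt, touches_iff]
      exact Or.inl h
    · intro γ hγ γ' hγ' h
      rcases D.circleOf_flipAt h with h | h
      · rwa [hrep, hrep] at h
      · exact absurd h.1 (hmem γ hγ)
    · intro γ' hγ'
      obtain ⟨y, rfl⟩ := circleOf_surjective (D := D) (flipAt c t) γ'
      have hy : ¬ D.Touches t c y := by
        intro h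
        exact (Finset.ne_of_mem_erase hγ') (hj'.circleOf_eq h.flipAt (D.touches_self _ _ _))
      refine ⟨D.circleOf t y, ?_, circleOf_flipAt_of_not_joined hj (hrep _)⟩
      rw [touches_iff, not_or] at hy
      exact Finset.mem_erase.2 ⟨hy.2, Finset.mem_erase.2 ⟨hy.1, Finset.mem_univ _⟩⟩
    · intro γ hγ
      have := hoff (rep γ) (hmem γ hγ)
      simp only [EnhancedState.sg, hrep] at this
      rw [this]
  simp only [EnhancedState.tau, EnhancedState.sg]
  linarith

/-- The incidence relation between enhanced states whose markers differ exactly at `c`, in both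
directions. -/
def FlipIncident (c : C) (S S' : D.EnhancedState) : Prop :=
  S'.marker = flipAt c S.marker ∧ (∀ x, ¬ D.Touches S.marker c x → S'.sg x = S.sg x) ∧
    S'.tau = S.tau + 1

theorem tau_of_split {S S' : D.EnhancedState} {c : C} (hm : S'.marker = flipAt c S.marker)
    (hj : D.Joined S.marker c)
    (hoff : ∀ x, ¬ D.Touches S.marker c x → S'.sg x = S.sg x) :
    S'.tau = S.tau + S'.sg (c, 0) + S'.sg (c, 2) - S.sg (c, 0) := by
  have h := tau_of_merge (S := S') (S' := S) (c := c) (by rw [hm, flipAt_flipAt])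
    (by rw [hm, joined_flipAt, not_not]; exact hj)
    (fun x hx => (hoff x (by rwa [hm, touches_flipAt] at hx)).symm)
  linarith

/-- Three circles touch c before and after the change together, so 3 is the largest possible
increase and forces every one of their signs. -/
theorem sg_of_tau_eq_add_three {S S' : D.EnhancedState} {c : C}
    (hm : S'.marker = flipAt c S.marker)
    (hoff : ∀ x, ¬ D.Touches S.marker c x → S'.sg x = S.sg x) (htau : S'.tau = S.tau + 3)
    {x : Dart C} (hx : D.Touches S.marker c x) : S.sg x = -1 ∧ S'.sg x = 1 := by
  have hx' : D.Touches S'.marker c x := by rw [hm]; exact hx.flipAt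
  by_cases hj : D.Joined S.marker c
  · have h := tau_of_split hm hj hoff
    rw [htau] at h
    rw [S.sg_congr (hj.circleOf_eq hx (D.touches_self _ c 0))]
    rw [touches_iff] at hx'
    have h3 : S.sg (c, 0) = -1 ∧ S'.sg (c, 0) = 1 ∧ S'.sg (c, 2) = 1 := by
      rcases Int.units_eq_one_or (S.sg (c, 0)) with h0 | h0 <;>
      rcases Int.units_eq_one_or (S'.sg (c, 0)) with h1 | h1 <;>
      rcases Int.units_eq_one_or (S'.sg (c, 2)) with h2 | h2 <;>
      simp [h0, h1, h2] at h ⊢ <;> omega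
    rcases hx' with hx' | hx' <;> rw [S'.sg_congr hx']
    exacts [⟨h3.1, h3.2.1⟩, ⟨h3.1, h3.2.2⟩]
  · have h := tau_of_merge hm hj hoff
    rw [htau] at h
    have hj' : D.Joined S'.marker c := by rwa [hm, joined_flipAt]
    rw [S'.sg_congr (hj'.circleOf_eq hx' (D.touches_self _ c 0))]
    rw [touches_iff] at hx
    have h3 : S'.sg (c, 0) = 1 ∧ S.sg (c, 0) = -1 ∧ S.sg (c, 2) = -1 := by
      rcases Int.units_eq_one_or (S'.sg (c, 0)) with h0 | h0 <;>
      rcases Int.units_eq_one_or (S.sg (c, 0)) with h1 | h1 <;>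
      rcases Int.units_eq_one_or (S.sg (c, 2)) with h2 | h2 <;>
      simp [h0, h1, h2] at h ⊢ <;> omega
    rcases hx with hx | hx <;> rw [S.sg_congr hx]
    exacts [⟨h3.2.1, h3.1⟩, ⟨h3.2.2, h3.1⟩]

/-- This is the coefficientwise form of the commutation of the edge map with multiplication by X
(`flipMap_raise`). Both sides force τ(S') = τ(S) + 3. If the circle of x touches c,
`sg_of_tau_eq_add_three` fixes the signs; otherwise the circle survives the change and carries its
sign along. -/
theorem flipIncident_setSign_iff (c : C) (x : Dart C) (S S' : D.EnhancedState) :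
    (S'.sg x = 1 ∧ FlipIncident c S (S'.setSign x (-1))) ↔
      (S.sg x = -1 ∧ FlipIncident c (S.setSign x 1) S') := by
  simp only [FlipIncident, EnhancedState.setSign_marker, EnhancedState.setSign_tau]
  have hcirc : S'.marker = flipAt c S.marker → ∀ y, ¬ D.Touches S.marker c y →
      (D.circleOf S'.marker y = D.circleOf S'.marker x ↔
        D.circleOf S.marker y = D.circleOf S.marker x) := by
    intro hm y hy
    constructor
    · intro h
      rw [hm] at h
      exact (D.circleOf_flipAt h).resolve_right fun h => hy h.1
    · intro h
      rw [← flipAt_flipAt c S.marker, ← hm] at h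
      refine (D.circleOf_flipAt h).resolve_right fun h => hy ?_
      rw [← touches_flipAt, ← hm]; exact h.1
  constructor
  · rintro ⟨h1, hm, hoff, htau⟩
    rw [h1] at htau
    have htau' : S'.tau = S.tau + 3 := by
      simp at htau; linarith
    by_cases hx : D.Touches S.marker c x
    · have hoff' : ∀ y, ¬ D.Touches S.marker c y → S'.sg y = S.sg y := by
        intro y hy
        rw [← hoff y hy, S'.setSign_sg_of_ne]
        rw [Ne, hcirc hm y hy]
        exact fun h => hy (hx.congr h.symm)
      have h2 := (sg_of_tau_eq_add_three hm hoff' htau' hx).1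
      refine ⟨h2, hm, fun y hy => ?_, by rw [h2]; simp; linarith⟩
      rw [hoff' y hy, S.setSign_sg_of_ne]
      exact fun h => hy (hx.congr h.symm)
    · have h2 := hoff x hx
      rw [S'.setSign_sg_self] at h2
      refine ⟨h2.symm, hm, fun y hy => ?_, by rw [← h2]; simp; linarith⟩
      have h3 := hoff y hy
      by_cases hy' : D.circleOf S.marker y = D.circleOf S.marker x
      · rw [S.setSign_sg_of_eq 1 hy', S'.sg_congr ((hcirc hm y hy).2 hy'), h1]
      · rw [S.setSign_sg_of_ne 1 hy', ← h3, S'.setSign_sg_of_ne]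
        rwa [Ne, hcirc hm y hy]
  · rintro ⟨h1, hm, hoff, htau⟩
    rw [h1] at htau
    have htau' : S'.tau = S.tau + 3 := by
      simp at htau; linarith
    by_cases hx : D.Touches S.marker c x
    · have hoff' : ∀ y, ¬ D.Touches S.marker c y → S'.sg y = S.sg y := by
        intro y hy
        rw [hoff y hy, S.setSign_sg_of_ne]
        exact fun h => hy (hx.congr h.symm)
      have h2 := (sg_of_tau_eq_add_three hm hoff' htau' hx).2
      refine ⟨h2, hm, fun y hy => ?_, by rw [h2]; simp; linarith⟩
      rw [← hoff' y hy, S'.setSign_sg_of_ne]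
      rw [Ne, hcirc hm y hy]
      exact fun h => hy (hx.congr h.symm)
    · have h2 := hoff x hx
      rw [S.setSign_sg_self] at h2
      refine ⟨h2, hm, fun y hy => ?_, by rw [h2]; simp; linarith⟩
      have h3 := hoff y hy
      by_cases hy' : D.circleOf S.marker y = D.circleOf S.marker x
      · rw [S'.setSign_sg_of_eq (-1) ((hcirc hm y hy).2 hy'), S.sg_congr hy', h1]
      · rw [S'.setSign_sg_of_ne (-1) (by rwa [Ne, hcirc hm y hy]), h3, S.setSign_sg_of_ne 1 hy']

/-- The multiplication rule 1 · 1 = 1. -/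
theorem flipIncident_allNeg_of_not_joined {t : State C} {c : C} (hj : ¬ D.Joined t c)
    (S' : D.EnhancedState) :
    FlipIncident c (EnhancedState.allNeg D t) S' ↔
      S' = EnhancedState.allNeg D (flipAt c t) := by
  constructor
  · rintro ⟨hm, hoff, htau⟩
    have h := tau_of_merge (S := EnhancedState.allNeg D t) hm hj hoff
    have h0 : S'.sg (c, 0) = -1 := by
      rcases Int.units_eq_one_or (S'.sg (c, 0)) with h0 | h0
      · simp [h0] at h; omega
      · exact h0
    refine EnhancedState.ext_sg hm fun x => ?_
    by_cases hx : D.Touches t c x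
    · rw [EnhancedState.allNeg_sg, ← h0]
      refine S'.sg_congr ?_
      rw [hm]
      exact ((D.joined_flipAt t c).2 hj).circleOf_eq hx.flipAt (D.touches_self _ _ _)
    · exact hoff x hx
  · rintro rfl
    have h := tau_of_merge (S := EnhancedState.allNeg D t)
      (S' := EnhancedState.allNeg D (flipAt c t)) rfl hj (fun _ _ => rfl)
    exact ⟨rfl, fun _ _ => rfl, by simp at h; linarith⟩

/-- The comultiplication rule Δ(1) = X ⊗ 1 + 1 ⊗ X. -/
theorem flipIncident_allNeg_of_joined {t : State C} {c : C} (hj : D.Joined t c)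
    (S' : D.EnhancedState) :
    FlipIncident c (EnhancedState.allNeg D t) S' ↔
      S' = (EnhancedState.allNeg D (flipAt c t)).setSign (c, 0) 1 ∨
      S' = (EnhancedState.allNeg D (flipAt c t)).setSign (c, 2) 1 := by
  have hj' : D.circleOf (flipAt c t) (c, 0) ≠ D.circleOf (flipAt c t) (c, 2) := by
    have := (D.joined_flipAt t c).not.2 (not_not.2 hj)
    exact this
  have key : ∀ S' : D.EnhancedState, ∀ a b : Dart C, (∀ x, D.Touches t c x ↔
      D.circleOf (flipAt c t) x = D.circleOf (flipAt c t) a ∨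
      D.circleOf (flipAt c t) x = D.circleOf (flipAt c t) b) →
      S'.marker = flipAt c t → (∀ x, ¬ D.Touches t c x → S'.sg x = -1) → S'.sg a = 1 →
      S'.sg b = -1 → S' = (EnhancedState.allNeg D (flipAt c t)).setSign a 1 := by
    intro S' a b hT hm hoff ha hb
    refine EnhancedState.ext_sg hm fun x => ?_
    by_cases hx : D.circleOf (flipAt c t) x = D.circleOf (flipAt c t) a
    · rw [EnhancedState.setSign_sg_of_eq _ 1 hx, ← ha]
      exact S'.sg_congr (by rwa [hm])
    · rw [EnhancedState.setSign_sg_of_ne _ 1 hx, EnhancedState.allNeg_sg]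
      by_cases hxb : D.circleOf (flipAt c t) x = D.circleOf (flipAt c t) b
      · rw [← hb]
        exact S'.sg_congr (by rwa [hm])
      · exact hoff x fun h => ((hT x).1 h).elim hx hxb
  have hT : ∀ x, D.Touches t c x ↔ D.circleOf (flipAt c t) x = D.circleOf (flipAt c t) (c, 0) ∨
      D.circleOf (flipAt c t) x = D.circleOf (flipAt c t) (c, 2) := fun x => by
    rw [← touches_flipAt, touches_iff]
  constructor
  · rintro ⟨hm, hoff, htau⟩
    have h := tau_of_split (S := EnhancedState.allNeg D t) hm hj hoff
    rw [htau] at h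
    simp only [EnhancedState.allNeg_sg] at h
    rcases Int.units_eq_one_or (S'.sg (c, 0)) with h0 | h0 <;>
    rcases Int.units_eq_one_or (S'.sg (c, 2)) with h2 | h2 <;> rw [h0, h2] at h <;>
      simp at h
    · exact absurd h (by omega)
    · exact Or.inl (key S' _ _ hT hm hoff h0 h2)
    · exact Or.inr (key S' _ _ (fun x => (hT x).trans or_comm) hm hoff h2 h0)
  · have hoff : ∀ (a : ZMod 4) (x : Dart C), ¬ D.Touches t c x →
        ((EnhancedState.allNeg D (flipAt c t)).setSign (c, a) 1).sg x =
          (EnhancedState.allNeg D t).sg x := by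
      intro a x hx
      rw [EnhancedState.setSign_sg_of_ne]
      · rfl
      · intro h
        rw [← touches_flipAt] at hx
        exact hx ⟨a, h.symm⟩
    rintro (rfl | rfl)
    · refine ⟨rfl, hoff 0, ?_⟩
      have h := tau_of_split (S := EnhancedState.allNeg D t) rfl hj (hoff 0)
      rw [EnhancedState.setSign_sg_self, EnhancedState.setSign_sg_of_ne _ _ hj'.symm] at h
      simp at h
      exact h
    · refine ⟨rfl, hoff 2, ?_⟩
      have h := tau_of_split (S := EnhancedState.allNeg D t) rfl hj (hoff 2)
      rw [EnhancedState.setSign_sg_self, EnhancedState.setSign_sg_of_ne _ _ hj'] at h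
      simp at h
      exact h

end Merge

end LinkDiagram

/-! ### Multiplication by X and the unsigned edge maps. -/

namespace LinkDiagram

variable {C : Type*} {D : LinkDiagram C}

/-- A basis element of the chain group. -/
noncomputable abbrev gen (S : D.EnhancedState) : D.Chain := Finsupp.single S 1

theorem chain_hom_ext {Φ Ψ : D.Chain →ₗ[ℤ] D.Chain} (h : ∀ S, Φ (gen S) = Ψ (gen S)) : Φ = Ψ :=
  Finsupp.lhom_ext' fun S => LinearMap.ext_ring (h S)

theorem eq_of_mem_supported {Φ Ψ : D.Chain →ₗ[ℤ] D.Chain} {P : Set D.EnhancedState} {z : D.Chain}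
    (hz : z ∈ Finsupp.supported ℤ ℤ P) (h : ∀ S ∈ P, Φ (gen S) = Ψ (gen S)) : Φ z = Ψ z := by
  rw [Finsupp.supported_eq_span_single] at hz
  refine LinearMap.eqOn_span ?_ hz
  rintro _ ⟨S, hS, rfl⟩
  exact h S hS

theorem supported_le_of_gen_mem {P : Set D.EnhancedState} {N : Submodule ℤ D.Chain}
    (h : ∀ S ∈ P, gen S ∈ N) : Finsupp.supported ℤ ℤ P ≤ N := by
  rw [Finsupp.supported_eq_span_single, Submodule.span_le]
  rintro _ ⟨S, hS, rfl⟩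
  exact h S hS

theorem map_mem_supported {Φ : D.Chain →ₗ[ℤ] D.Chain} {P Q : Set D.EnhancedState} {z : D.Chain}
    (hz : z ∈ Finsupp.supported ℤ ℤ P)
    (h : ∀ S ∈ P, Φ (gen S) ∈ Finsupp.supported ℤ ℤ Q) : Φ z ∈ Finsupp.supported ℤ ℤ Q :=
  supported_le_of_gen_mem (N := (Finsupp.supported ℤ ℤ Q).comap Φ) h hz

theorem gen_mem_supported {P : Set D.EnhancedState} {S : D.EnhancedState} (h : S ∈ P) :
    gen S ∈ Finsupp.supported ℤ ℤ P := Finsupp.single_mem_supported ℤ 1 h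

open Classical in
/-- Make the circle through the dart `x` positive; this gives zero if it is positive already. -/
noncomputable def raise (x : Dart C) : D.Chain →ₗ[ℤ] D.Chain :=
  Finsupp.linearCombination ℤ fun S => if S.sg x = -1 then gen (S.setSign x 1) else 0

open Classical in
/-- Make the circle through the dart `x` negative; this gives zero if it is negative already. -/
noncomputable def lower (x : Dart C) : D.Chain →ₗ[ℤ] D.Chain :=
  Finsupp.linearCombination ℤ fun S => if S.sg x = 1 then gen (S.setSign x (-1)) else 0

theorem raise_gen_of_neg {x : Dart C} {S : D.EnhancedState} (h : S.sg x = -1) :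
    raise x (gen S) = gen (S.setSign x 1) := by
  simp [raise, h]

theorem raise_gen_of_pos {x : Dart C} {S : D.EnhancedState} (h : S.sg x = 1) :
    raise x (gen S) = 0 := by
  simp [raise, h]

theorem lower_gen_of_pos {x : Dart C} {S : D.EnhancedState} (h : S.sg x = 1) :
    lower x (gen S) = gen (S.setSign x (-1)) := by
  simp [lower, h]

theorem lower_gen_of_neg {x : Dart C} {S : D.EnhancedState} (h : S.sg x = -1) :
    lower x (gen S) = 0 := by
  simp [lower, h]

theorem raise_eq_of_mem_supported {x y : Dart C} {z : D.Chain}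
    (hz : z ∈ Finsupp.supported ℤ ℤ
      {S : D.EnhancedState | D.circleOf S.marker x = D.circleOf S.marker y}) :
    raise x z = raise y z := by
  refine eq_of_mem_supported hz fun S hS => ?_
  have h := S.sg_congr hS
  rcases Int.units_eq_one_or (S.sg x) with hx | hx
  · rw [raise_gen_of_pos hx, raise_gen_of_pos (h ▸ hx)]
  · rw [raise_gen_of_neg hx, raise_gen_of_neg (h ▸ hx), S.setSign_congr 1 hS]

theorem raise_raise_self (x : Dart C) (z : D.Chain) : raise x (raise x z) = 0 := by
  suffices raise x ∘ₗ raise x = (0 : D.Chain →ₗ[ℤ] D.Chain) from LinearMap.congr_fun this z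
  refine chain_hom_ext fun S => ?_
  rw [LinearMap.comp_apply]
  rcases Int.units_eq_one_or (S.sg x) with hx | hx
  · simp [raise_gen_of_pos hx]
  · rw [raise_gen_of_neg hx, raise_gen_of_pos (S.setSign_sg_self x 1)]; rfl

theorem raise_comm (x y : Dart C) (z : D.Chain) : raise x (raise y z) = raise y (raise x z) := by
  suffices raise x ∘ₗ raise y = (raise y ∘ₗ raise x : D.Chain →ₗ[ℤ] D.Chain) from
    LinearMap.congr_fun this z
  refine chain_hom_ext fun S => ?_
  rw [LinearMap.comp_apply, LinearMap.comp_apply]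
  by_cases hxy : D.circleOf S.marker x = D.circleOf S.marker y
  · have h := S.sg_congr hxy
    rcases Int.units_eq_one_or (S.sg x) with hx | hx
    · rw [raise_gen_of_pos hx, raise_gen_of_pos (h ▸ hx), map_zero, map_zero]
    · rw [raise_gen_of_neg hx, raise_gen_of_neg (h ▸ hx),
        raise_gen_of_pos (S.setSign_sg_of_eq 1 hxy), raise_gen_of_pos (S.setSign_sg_of_eq 1 hxy.symm)]
  · have h1 := S.setSign_sg_of_ne 1 hxy
    have h2 := S.setSign_sg_of_ne 1 (Ne.symm hxy)
    rcases Int.units_eq_one_or (S.sg x) with hx | hx <;>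
    rcases Int.units_eq_one_or (S.sg y) with hy | hy
    · rw [raise_gen_of_pos hx, raise_gen_of_pos hy, map_zero, map_zero]
    · rw [raise_gen_of_pos hx, raise_gen_of_neg hy, raise_gen_of_pos (h1.trans hx), map_zero]
    · rw [raise_gen_of_neg hx, raise_gen_of_pos hy, raise_gen_of_pos (h2.trans hy), map_zero]
    · rw [raise_gen_of_neg hx, raise_gen_of_neg hy, raise_gen_of_neg (h2.trans hy),
        raise_gen_of_neg (h1.trans hx), S.setSign_comm 1 1 hxy]

theorem raise_lower_add_lower_raise (x : Dart C) (z : D.Chain) :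
    raise x (lower x z) + lower x (raise x z) = z := by
  suffices raise x ∘ₗ lower x + lower x ∘ₗ raise x = (LinearMap.id : D.Chain →ₗ[ℤ] D.Chain) from
    LinearMap.congr_fun this z
  refine chain_hom_ext fun S => ?_
  rw [LinearMap.add_apply, LinearMap.comp_apply, LinearMap.comp_apply, LinearMap.id_apply]
  rcases Int.units_eq_one_or (S.sg x) with hx | hx
  · rw [raise_gen_of_pos hx, lower_gen_of_pos hx, raise_gen_of_neg (S.setSign_sg_self x _), map_zero,
      S.setSign_setSign, S.setSign_eq_self hx, add_zero]
  · rw [raise_gen_of_neg hx, lower_gen_of_neg hx, lower_gen_of_pos (S.setSign_sg_self x _), map_zero,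
      S.setSign_setSign, S.setSign_eq_self hx, zero_add]

/-- Multiplication by X has kernel equal to its image, since `lower x` is a contracting homotopy for
it. -/
theorem eq_raise_lower {x : Dart C} {z : D.Chain} (hz : raise x z = 0) :
    z = raise x (lower x z) := by
  have := raise_lower_add_lower_raise x z
  rw [hz, map_zero, add_zero] at this
  exact this.symm

theorem lower_raise_comm {x y : Dart C} {z : D.Chain}
    (hz : z ∈ Finsupp.supported ℤ ℤ
      {S : D.EnhancedState | D.circleOf S.marker x ≠ D.circleOf S.marker y}) :
    lower x (raise y z) = raise y (lower x z) := by
  refine eq_of_mem_supported (Φ := lower x ∘ₗ raise y) (Ψ := raise y ∘ₗ lower x) hz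
    fun S hxy => ?_
  rw [LinearMap.comp_apply, LinearMap.comp_apply]
  have h1 := S.setSign_sg_of_ne 1 hxy
  have h2 := S.setSign_sg_of_ne (-1) (Ne.symm hxy)
  rcases Int.units_eq_one_or (S.sg x) with hx | hx <;>
  rcases Int.units_eq_one_or (S.sg y) with hy | hy
  · rw [raise_gen_of_pos hy, lower_gen_of_pos hx, raise_gen_of_pos (h2.trans hy), map_zero]
  · rw [raise_gen_of_neg hy, lower_gen_of_pos hx, lower_gen_of_pos (h1.trans hx),
      raise_gen_of_neg (h2.trans hy), S.setSign_comm (-1) 1 hxy]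
  · rw [raise_gen_of_pos hy, lower_gen_of_neg hx, map_zero, map_zero]
  · rw [raise_gen_of_neg hy, lower_gen_of_neg hx, lower_gen_of_neg (h1.trans hx), map_zero]

theorem raise_gen_mem_supported {P : Set D.EnhancedState} {x : Dart C} {S : D.EnhancedState}
    (h : S.sg x = -1 → S.setSign x 1 ∈ P) : raise x (gen S) ∈ Finsupp.supported ℤ ℤ P := by
  rcases Int.units_eq_one_or (S.sg x) with hx | hx
  · rw [raise_gen_of_pos hx]; exact zero_mem _
  · rw [raise_gen_of_neg hx]; exact gen_mem_supported (h hx)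

theorem lower_gen_mem_supported {P : Set D.EnhancedState} {x : Dart C} {S : D.EnhancedState}
    (h : S.sg x = 1 → S.setSign x (-1) ∈ P) : lower x (gen S) ∈ Finsupp.supported ℤ ℤ P := by
  rcases Int.units_eq_one_or (S.sg x) with hx | hx
  · rw [lower_gen_of_pos hx]; exact gen_mem_supported (h hx)
  · rw [lower_gen_of_neg hx]; exact zero_mem _

open Classical in
theorem raise_apply (x : Dart C) (z : D.Chain) (S : D.EnhancedState) :
    raise x z S = if S.sg x = 1 then z (S.setSign x (-1)) else 0 := by
  induction z using Finsupp.induction_linear with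
  | zero => simp
  | add z w hz hw =>
    rw [map_add, Finsupp.add_apply, hz, hw]
    split_ifs <;> simp
  | single T n =>
    have h1 : (Finsupp.single T n : D.Chain) = n • gen T := by simp
    rw [h1, map_smul]
    rcases Int.units_eq_one_or (T.sg x) with hT | hT
    · rw [raise_gen_of_pos hT]
      split_ifs with h
      · have : S.setSign x (-1) ≠ T := by
          rintro rfl
          rw [S.setSign_sg_self] at hT
          exact absurd hT (by decide)
        simp [this.symm]
      · simp
    · rw [raise_gen_of_neg hT]
      split_ifs with h
      · have : T.setSign x 1 = S ↔ T = S.setSign x (-1) := by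
          constructor
          · rintro rfl
            rw [T.setSign_setSign, T.setSign_eq_self hT]
          · rintro rfl
            rw [S.setSign_setSign, S.setSign_eq_self h]
        simp [Finsupp.single_apply, this]
      · have : T.setSign x 1 ≠ S := by
          rintro rfl
          exact h (T.setSign_sg_self x 1)
        simp [this]

section Fintype

variable [Fintype C]

/-- The enhanced states with marker `t` are obtained from the all-negative one by raising. -/
theorem gen_mem_of_raise_mem [IsEmpty (Fin D.loops)] {N : Submodule ℤ D.Chain}
    (hN : ∀ x, ∀ z ∈ N, raise x z ∈ N) {S : D.EnhancedState}
    (hS : gen (EnhancedState.allNeg D S.marker) ∈ N) : gen S ∈ N := by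
  classical
  obtain ⟨t, e⟩ := S
  have key : ∀ U : Finset (D.Circle t),
      gen (D := D) ⟨t, fun γ => if γ ∈ U then 1 else -1⟩ ∈ N := by
    intro U
    induction U using Finset.induction_on with
    | empty => simpa [EnhancedState.allNeg] using hS
    | insert γ U hγ ih =>
      obtain ⟨x, rfl⟩ := circleOf_surjective (D := D) t γ
      have h1 := hN x _ ih
      rw [raise_gen_of_neg (by simp [EnhancedState.sg, hγ])] at h1
      convert h1 using 2
      refine EnhancedState.ext_sg rfl fun y => ?_
      rw [EnhancedState.setSign_sg]
      simp only [EnhancedState.sg, Finset.mem_insert]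
      by_cases h : D.circleOf t y = D.circleOf t x <;> simp [h]
  convert key (Finset.univ.filter fun γ => e γ = 1) using 3
  ext1 γ
  rcases Int.units_eq_one_or (e γ) with h | h <;> simp [h]

/-- The chains over one Kauffman state form a cyclic module over the multiplications by X, generated
by 1 ⊗ ... ⊗ 1. Identities between linear maps that commute with `raise` need a check only there. -/
theorem hom_ext_of_raise [IsEmpty (Fin D.loops)] {Φ Ψ : D.Chain →ₗ[ℤ] D.Chain}
    (hΦ : ∀ x z, Φ (raise x z) = raise x (Φ z)) (hΨ : ∀ x z, Ψ (raise x z) = raise x (Ψ z))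
    (h : ∀ t, Φ (gen (EnhancedState.allNeg D t)) = Ψ (gen (EnhancedState.allNeg D t))) :
    Φ = Ψ := by
  refine chain_hom_ext fun S => ?_
  have := gen_mem_of_raise_mem (N := LinearMap.eqLocus Φ Ψ) (S := S) ?_ (h S.marker)
  · exact this
  · intro x z hz
    rw [LinearMap.mem_eqLocus] at hz ⊢
    rw [hΦ, hΨ, hz]

variable [DecidableEq C]

open Classical in
/-- The unsigned edge map of the cube at the crossing `c`, in both directions. -/
noncomputable def flipMap (c : C) : D.Chain →ₗ[ℤ] D.Chain :=
  Finsupp.linearCombination ℤ fun S =>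
    ∑ S' : D.EnhancedState, if FlipIncident c S S' then gen S' else 0

open Classical in
theorem flipMap_gen_apply (c : C) (S S' : D.EnhancedState) :
    flipMap c (gen S) S' = if FlipIncident c S S' then 1 else 0 := by
  rw [flipMap, gen, Finsupp.linearCombination_single, one_smul, Finsupp.finsetSum_apply,
    Finset.sum_eq_single S']
  · split_ifs <;> simp
  · intro T _ hT
    split_ifs
    · exact Finsupp.single_eq_of_ne' hT
    · rfl
  · simp

theorem flipMap_gen_mem_supported {P : Set D.EnhancedState} {c : C} {S : D.EnhancedState}
    (h : ∀ S', FlipIncident c S S' → S' ∈ P) : flipMap c (gen S) ∈ Finsupp.supported ℤ ℤ P := by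
  classical
  rw [Finsupp.mem_supported']
  intro S' hS'
  rw [flipMap_gen_apply, if_neg fun h' => hS' (h S' h')]

section Commute

variable {c c' : C} {t : State C}

/-- The state graph of two crossings, when the second one changes whether the first is joined:
a joined pair separates. -/
theorem commute_joined (h0 : D.Joined t c) (h1 : ¬ D.Joined (flipAt c' t) c) :
    D.Joined t c' ∧ ¬ D.Joined (flipAt c t) c' ∧
      D.circleOf (flipAt c (flipAt c' t)) (c, 0) = D.circleOf (flipAt c (flipAt c' t)) (c', 0) := by
  have h2 := h0
  unfold Joined at h2
  rw [← flipAt_flipAt c' t] at h2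
  have h3 := (D.circleOf_flipAt h2).resolve_left h1
  rw [touches_iff, touches_iff] at h3
  have hmono : ∀ {x y}, D.circleOf (flipAt c' t) x = D.circleOf (flipAt c' t) y →
      D.circleOf (flipAt c (flipAt c' t)) x = D.circleOf (flipAt c (flipAt c' t)) y :=
    fun h => circleOf_flipAt_of_not_joined h1 h
  have hc : D.circleOf (flipAt c (flipAt c' t)) (c, 0) =
      D.circleOf (flipAt c (flipAt c' t)) (c, 2) := (D.joined_flipAt _ c).2 h1
  unfold Joined at h1
  have h4 : ¬ D.Joined (flipAt c' t) c' := by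
    intro h5
    unfold Joined at h5
    simp only [← h5, or_self] at h3
    exact h1 (h3.1.trans h3.2.symm)
  refine ⟨by rwa [joined_flipAt, not_not] at h4, ?_, ?_⟩
  · rw [← D.joined_flipAt, flipAt_comm, Joined]
    rcases h3 with ⟨h | h, h' | h'⟩
    · exact absurd (h.trans h'.symm) h1
    · exact ((hmono h).symm.trans hc).trans (hmono h')
    · exact ((hmono h').symm.trans hc.symm).trans (hmono h)
    · exact absurd (h.trans h'.symm) h1
  · rcases h3 with ⟨h | h, h' | h'⟩
    · exact hmono h
    · exact hmono h
    · exact hc.trans (hmono h')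
    · exact absurd (h.trans h'.symm) h1

/-- The state graph of two crossings, when the second one changes whether the first is joined:
a separated pair becomes joined. -/
theorem commute_not_joined (h0 : ¬ D.Joined t c)
    (h1 : D.Joined (flipAt c' t) c) :
    ¬ D.Joined t c' ∧ D.Joined (flipAt c t) c' ∧
      ((D.circleOf (flipAt c (flipAt c' t)) (c', 0) =
          D.circleOf (flipAt c (flipAt c' t)) (c, 0) ∧
        D.circleOf (flipAt c (flipAt c' t)) (c', 2) =
          D.circleOf (flipAt c (flipAt c' t)) (c, 2)) ∨
       (D.circleOf (flipAt c (flipAt c' t)) (c', 0) =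
          D.circleOf (flipAt c (flipAt c' t)) (c, 2) ∧
        D.circleOf (flipAt c (flipAt c' t)) (c', 2) =
          D.circleOf (flipAt c (flipAt c' t)) (c, 0))) := by
  have h3 := (D.circleOf_flipAt h1).resolve_left h0
  rw [touches_iff, touches_iff] at h3
  have hmono : ∀ {x y}, D.circleOf t x = D.circleOf t y →
      D.circleOf (flipAt c t) x = D.circleOf (flipAt c t) y :=
    fun h => circleOf_flipAt_of_not_joined h0 h
  have hc : D.circleOf (flipAt c t) (c, 0) = D.circleOf (flipAt c t) (c, 2) :=
    (D.joined_flipAt _ c).2 h0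
  have h0' := h0
  unfold Joined at h0'
  have h4 : ¬ D.Joined t c' := by
    intro h5
    unfold Joined at h5
    simp only [← h5, or_self] at h3
    exact h0' (h3.1.trans h3.2.symm)
  have h5 : D.Joined (flipAt c t) c' := by
    rcases h3 with ⟨h | h, h' | h'⟩
    · exact absurd (h.trans h'.symm) h0'
    · exact ((hmono h).symm.trans hc).trans (hmono h')
    · exact ((hmono h').symm.trans hc.symm).trans (hmono h)
    · exact absurd (h.trans h'.symm) h0'
  refine ⟨h4, h5, ?_⟩
  have hmono' : ∀ {x y}, D.circleOf t x = D.circleOf t y →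
      D.circleOf (flipAt c' t) x = D.circleOf (flipAt c' t) y :=
    fun h => circleOf_flipAt_of_not_joined h4 h
  have h6 : D.Joined (flipAt c' t) c' := (D.joined_flipAt _ _).2 h4
  have h7 : D.Touches (flipAt c' t) c' (c, 0) := by
    refine Touches.flipAt ?_
    rw [touches_iff]; exact h3.1
  have h8 : ∀ a, D.circleOf (flipAt c' t) (c', a) = D.circleOf (flipAt c' t) (c, 0) := fun a =>
    h6.circleOf_eq (D.touches_self _ _ _) h7
  have h9 : ∀ a, D.Touches (flipAt c (flipAt c' t)) c (c', a) := fun a =>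
    (Touches.flipAt ⟨0, (h8 a).symm⟩)
  have h10 : D.circleOf (flipAt c (flipAt c' t)) (c', 0) ≠
      D.circleOf (flipAt c (flipAt c' t)) (c', 2) := by
    rw [flipAt_comm]
    exact (D.joined_flipAt (flipAt c t) c').not.2 (not_not.2 h5)
  have h11 := h9 0
  have h12 := h9 2
  rw [touches_iff] at h11 h12
  rcases h11 with h | h <;> rcases h12 with h' | h'
  · exact absurd (h.trans h'.symm) h10
  · exact Or.inl ⟨h, h'⟩
  · exact Or.inr ⟨h, h'⟩
  · exact absurd (h.trans h'.symm) h10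

end Commute

variable [IsEmpty (Fin D.loops)]

/-- Merging and splitting are linear over the action of X at any dart; compare coefficients with
`flipIncident_setSign_iff`. -/
theorem flipMap_raise (c : C) (x : Dart C) (z : D.Chain) :
    flipMap c (raise x z) = raise x (flipMap c z) := by
  suffices flipMap c ∘ₗ raise x = (raise x ∘ₗ flipMap c : D.Chain →ₗ[ℤ] D.Chain) from
    LinearMap.congr_fun this z
  classical
  refine chain_hom_ext fun S => ?_
  rw [LinearMap.comp_apply, LinearMap.comp_apply]
  ext S'
  rw [raise_apply, flipMap_gen_apply, ← ite_and]
  simp only [flipIncident_setSign_iff]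
  rcases Int.units_eq_one_or (S.sg x) with hx | hx
  · rw [raise_gen_of_pos hx, map_zero, Finsupp.coe_zero, Pi.zero_apply, if_neg]
    rintro ⟨h, -⟩
    rw [hx] at h
    exact absurd h (by decide)
  · rw [raise_gen_of_neg hx, flipMap_gen_apply]
    simp [hx]

theorem flipMap_allNeg_of_not_joined {t : State C} {c : C} (hj : ¬ D.Joined t c) :
    flipMap c (gen (EnhancedState.allNeg D t)) = gen (EnhancedState.allNeg D (flipAt c t)) := by
  classical
  ext S'
  rw [flipMap_gen_apply, Finsupp.single_apply]
  simp only [flipIncident_allNeg_of_not_joined hj, eq_comm]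

theorem flipMap_allNeg_of_joined {t : State C} {c : C} (hj : D.Joined t c) :
    flipMap c (gen (EnhancedState.allNeg D t)) =
      raise (c, 0) (gen (EnhancedState.allNeg D (flipAt c t))) +
        raise (c, 2) (gen (EnhancedState.allNeg D (flipAt c t))) := by
  classical
  have hj' : D.circleOf (flipAt c t) (c, 0) ≠ D.circleOf (flipAt c t) (c, 2) := by
    have := (D.joined_flipAt t c).not.2 (not_not.2 hj)
    exact this
  have hne : (EnhancedState.allNeg D (flipAt c t)).setSign (c, 0) 1 ≠
      (EnhancedState.allNeg D (flipAt c t)).setSign (c, 2) 1 := by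
    intro h
    have h1 := congrArg (fun S => S.sg (c, 0)) h
    simp only [EnhancedState.setSign_sg_self] at h1
    rw [EnhancedState.setSign_sg_of_ne _ 1 hj', EnhancedState.allNeg_sg] at h1
    exact absurd h1 (by decide)
  rw [raise_gen_of_neg rfl, raise_gen_of_neg rfl]
  ext S'
  rw [flipMap_gen_apply, Finsupp.add_apply, Finsupp.single_apply, Finsupp.single_apply]
  simp only [flipIncident_allNeg_of_joined hj, eq_comm (a := S')]
  split_ifs with h1 h2 h3 <;> simp_all

/-- Merging after splitting is multiplication by 2X, splitting after merging is multiplication by X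
⊗ 1 + 1 ⊗ X; both are the sum of the actions of X at two opposite darts. -/
theorem flipMap_flipMap (c : C) (z : D.Chain) :
    flipMap c (flipMap c z) = raise (c, 0) z + raise (c, 2) z := by
  suffices flipMap c ∘ₗ flipMap c = (raise (c, 0) + raise (c, 2) : D.Chain →ₗ[ℤ] D.Chain) from
    LinearMap.congr_fun this z
  refine hom_ext_of_raise (fun x z => ?_) (fun x z => ?_) fun t => ?_
  · simp [flipMap_raise]
  · simp only [LinearMap.add_apply, map_add, raise_comm _ x]
  · rw [LinearMap.comp_apply, LinearMap.add_apply]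
    have h := D.joined_flipAt t c
    by_cases hj : D.Joined t c
    · rw [flipMap_allNeg_of_joined hj, map_add, flipMap_raise, flipMap_raise,
        flipMap_allNeg_of_not_joined (h.not.2 (not_not.2 hj)), flipAt_flipAt]
    · rw [flipMap_allNeg_of_not_joined hj, flipMap_allNeg_of_joined (h.2 hj), flipAt_flipAt]

theorem flipMap_flipMap_eq (c : C) (a : ZMod 4) (z : D.Chain) :
    flipMap c (flipMap c z) = raise (c, a) z + raise (c, a + 2) z := by
  rw [flipMap_flipMap]
  refine eq_of_mem_supported (Φ := raise (c, 0) + raise (c, 2))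
    (Ψ := raise (c, a) + raise (c, a + 2)) (P := Set.univ) (by simp) fun S _ => ?_
  rw [LinearMap.add_apply, LinearMap.add_apply]
  rcases D.circleOf_opposite S.marker c a with ⟨h1, h2⟩ | ⟨h1, h2⟩
  · rw [raise_eq_of_mem_supported (gen_mem_supported h1),
      raise_eq_of_mem_supported (gen_mem_supported h2)]
  · rw [raise_eq_of_mem_supported (gen_mem_supported h1),
      raise_eq_of_mem_supported (gen_mem_supported h2), add_comm]

/-- Evaluated on the all-negative states, where only the merge/split pattern of the two crossings
matters. -/
theorem flipMap_comm (c c' : C) (z : D.Chain) :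
    flipMap c (flipMap c' z) = flipMap c' (flipMap c z) := by
  by_cases hne : c = c'
  · rw [hne]
  suffices flipMap c ∘ₗ flipMap c' = (flipMap c' ∘ₗ flipMap c : D.Chain →ₗ[ℤ] D.Chain) from
    LinearMap.congr_fun this z
  refine hom_ext_of_raise (fun x z => ?_) (fun x z => ?_) fun t => ?_
  · simp [flipMap_raise]
  · simp [flipMap_raise]
  rw [LinearMap.comp_apply, LinearMap.comp_apply]
  have hcomm := flipAt_comm c c' t
  by_cases h0 : D.Joined t c <;> by_cases h1 : D.Joined (flipAt c' t) c <;>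
  by_cases h2 : D.Joined t c' <;> by_cases h3 : D.Joined (flipAt c t) c'
  -- Six of the sixteen patterns survive: four in which neither crossing affects the other's type,
  -- and two in which each reverses it. In these two, both composites act by X at opposite darts of
  -- the same circles: as merge after split, or as split after merge.
  all_goals first
    | (exfalso; have := commute_joined h0 h1; tauto)
    | (exfalso; have := commute_not_joined h0 h1; tauto)
    | (exfalso; have := commute_joined h2 h3; tauto)
    | (exfalso; have := commute_not_joined h2 h3; tauto)
    | skip
  · simp only [flipMap_allNeg_of_joined, h0, h1, h2, h3, map_add, flipMap_raise, hcomm,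
      raise_comm (c', _) (c, _)]
    abel
  · simp only [flipMap_allNeg_of_joined, flipMap_allNeg_of_not_joined, h0, h1, h2, h3, map_add,
      flipMap_raise, hcomm, not_false_eq_true]
  · obtain ⟨-, -, h4⟩ := commute_joined h0 h1
    have h5 : D.circleOf (flipAt c (flipAt c' t)) (c, 0) =
      D.circleOf (flipAt c (flipAt c' t)) (c, 2) := (D.joined_flipAt _ c).2 h1
    have h6 : D.circleOf (flipAt c (flipAt c' t)) (c', 0) =
      D.circleOf (flipAt c (flipAt c' t)) (c', 2) := by
      rw [flipAt_comm]; exact (D.joined_flipAt _ c').2 h3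
    simp only [flipMap_allNeg_of_joined, flipMap_allNeg_of_not_joined, h0, h1, h2, h3, map_add,
      flipMap_raise, ← hcomm, not_false_eq_true]
    rw [← raise_eq_of_mem_supported (x := (c, 0)) (y := (c, 2)) (gen_mem_supported h5),
      ← raise_eq_of_mem_supported (x := (c', 0)) (y := (c', 2)) (gen_mem_supported h6),
      raise_eq_of_mem_supported (x := (c, 0)) (y := (c', 0)) (gen_mem_supported h4)]
  · obtain ⟨-, -, h4⟩ := commute_not_joined h0 h1
    simp only [flipMap_allNeg_of_joined, flipMap_allNeg_of_not_joined, h0, h1, h2, h3,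
      ← hcomm, not_false_eq_true]
    have hr : ∀ {x y}, D.circleOf (flipAt c (flipAt c' t)) x =
        D.circleOf (flipAt c (flipAt c' t)) y →
        raise x (gen (EnhancedState.allNeg D (flipAt c (flipAt c' t)))) =
          raise y (gen (EnhancedState.allNeg D (flipAt c (flipAt c' t)))) :=
      fun h => raise_eq_of_mem_supported (gen_mem_supported h)
    rcases h4 with ⟨h4, h5⟩ | ⟨h4, h5⟩
    · rw [hr h4, hr h5]
    · rw [hr h4, hr h5, add_comm]
  · simp only [flipMap_allNeg_of_joined, flipMap_allNeg_of_not_joined, h0, h1, h2, h3, map_add,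
      flipMap_raise, hcomm, not_false_eq_true]
  · simp only [flipMap_allNeg_of_not_joined, h0, h1, h2, h3, hcomm, not_false_eq_true]

/-- Merging is onto: it sends 1 ⊗ 1 to 1 and is linear over X. -/
theorem exists_flipMap_eq {c : C} {z : D.Chain}
    (hz : z ∈ Finsupp.supported ℤ ℤ {S : D.EnhancedState | D.Joined S.marker c}) :
    ∃ w ∈ Finsupp.supported ℤ ℤ {S : D.EnhancedState | ¬ D.Joined S.marker c},
      flipMap c w = z := by
  suffices h : Finsupp.supported ℤ ℤ {S : D.EnhancedState | D.Joined S.marker c} ≤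
      (Finsupp.supported ℤ ℤ {S : D.EnhancedState | ¬ D.Joined S.marker c}).map (flipMap c) by
    exact h hz
  refine supported_le_of_gen_mem fun S hS => gen_mem_of_raise_mem ?_ ?_
  · rintro x _ ⟨w, hw, rfl⟩
    refine ⟨raise x w, map_mem_supported hw fun S hS => raise_gen_mem_supported fun _ => hS, ?_⟩
    rw [flipMap_raise]
  · have h : ¬ D.Joined (flipAt c S.marker) c := (D.joined_flipAt _ _).not.2 (not_not.2 hS)
    refine ⟨gen (EnhancedState.allNeg D (flipAt c S.marker)), gen_mem_supported h, ?_⟩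
    rw [flipMap_allNeg_of_not_joined h, flipAt_flipAt]

/-- On chains that are killed by raising at the dart `(c, a)`, splitting at `c`, lowering the sign
of the new circle and merging again is the identity. -/
theorem flipMap_lower_flipMap {c : C} (a : ZMod 4) {z : D.Chain}
    (hz : z ∈ Finsupp.supported ℤ ℤ {S : D.EnhancedState | D.Joined S.marker c})
    (hr : raise (c, a) z = 0) : flipMap c (lower (c, a + 2) (flipMap c z)) = z := by
  have hlow : lower (c, a) z ∈ Finsupp.supported ℤ ℤ
      {S : D.EnhancedState | D.Joined S.marker c} :=
    map_mem_supported hz fun S hS => lower_gen_mem_supported fun _ => hS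
  obtain ⟨u, hu, hFu⟩ := exists_flipMap_eq hlow
  have hne : ∀ {w : D.Chain},
      w ∈ Finsupp.supported ℤ ℤ {S : D.EnhancedState | ¬ D.Joined S.marker c} →
      lower (c, a + 2) (raise (c, a) w) = raise (c, a) (lower (c, a + 2) w) := by
    intro w hw
    refine lower_raise_comm (Finsupp.supported_mono (fun S hS => ?_) hw)
    exact fun h => hS ((joined_iff D _ _ a).2 h.symm)
  -- Locally z is X on the joined circle, and w is X ⊗ 1 on the two separated circles, with X at (c,
  -- a); merging w gives z.
  set w := raise (c, a) u with hw
  have hwz : flipMap c w = z := by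
    rw [hw, flipMap_raise, hFu, ← eq_raise_lower hr]
  have hws : w ∈ Finsupp.supported ℤ ℤ {S : D.EnhancedState | ¬ D.Joined S.marker c} :=
    map_mem_supported hu fun S hS => raise_gen_mem_supported fun _ => hS
  have hw0 : raise (c, a) w = 0 := by rw [hw, raise_raise_self]
  have h1 := raise_lower_add_lower_raise (c, a + 2) w
  have h2 : flipMap c (flipMap c w) = raise (c, a + 2) w := by
    rw [flipMap_flipMap_eq c a, hw0, zero_add]
  rw [← hwz, h2, eq_sub_of_add_eq' h1, map_sub, flipMap_raise c (c, a + 2)]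
  -- After the merge the darts (c, a) and (c, a + 2) share a circle, so the error term can be
  -- multiplied by X at (c, a) instead, which kills it.
  have h3 : flipMap c (lower (c, a + 2) w) ∈ Finsupp.supported ℤ ℤ
      {S : D.EnhancedState | D.circleOf S.marker (c, a + 2) = D.circleOf S.marker (c, a)} := by
    refine map_mem_supported (P := {S : D.EnhancedState | ¬ D.Joined S.marker c})
      (map_mem_supported hws fun S hS => lower_gen_mem_supported fun _ => hS) fun S hS =>
      flipMap_gen_mem_supported fun S' hS' => ?_
    have := (D.joined_flipAt S.marker c).2 hS
    rw [← hS'.1, joined_iff D _ _ a] at this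
    exact this.symm
  rw [raise_eq_of_mem_supported h3, ← flipMap_raise, ← hne hws, hw0, map_zero, map_zero, sub_zero]

end Fintype

end LinkDiagram

/-! ### Signs, and the differential as a sum of edge maps of the cube. -/

namespace LinkDiagram

variable {C : Type*} {D : LinkDiagram C}

/-- The part of a chain with positive marker at `c`. -/
noncomputable def plusPart (c : C) : D.Chain →ₗ[ℤ] D.Chain :=
  Finsupp.linearCombination ℤ fun S => if S.marker c = 1 then gen S else 0

theorem plusPart_eq_self {c : C} {z : D.Chain}
    (hz : z ∈ Finsupp.supported ℤ ℤ {S : D.EnhancedState | S.marker c = 1}) :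
    plusPart c z = z :=
  eq_of_mem_supported (Ψ := LinearMap.id) hz fun S hS => by
    simp [plusPart, show S.marker c = 1 from hS]

theorem plusPart_eq_zero {c : C} {z : D.Chain}
    (hz : z ∈ Finsupp.supported ℤ ℤ {S : D.EnhancedState | S.marker c = -1}) :
    plusPart c z = 0 :=
  eq_of_mem_supported (Ψ := 0) hz fun S hS => by
    simp [plusPart, show S.marker c = -1 from hS]

theorem plusPart_mem_supported {P : Set D.EnhancedState} {c : C} {z : D.Chain}
    (hz : z ∈ Finsupp.supported ℤ ℤ P) :
    plusPart c z ∈ Finsupp.supported ℤ ℤ {S | S ∈ P ∧ S.marker c = 1} := by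
  refine map_mem_supported hz fun S hS => ?_
  rcases Int.units_eq_one_or (S.marker c) with h | h
  · simpa [plusPart, h] using gen_mem_supported (P := {S | S ∈ P ∧ S.marker c = 1}) ⟨hS, h⟩
  · simp [plusPart, h]

theorem sub_plusPart_mem_supported {P : Set D.EnhancedState} {c : C} {z : D.Chain}
    (hz : z ∈ Finsupp.supported ℤ ℤ P) :
    z - plusPart c z ∈ Finsupp.supported ℤ ℤ {S | S ∈ P ∧ S.marker c = -1} := by
  refine map_mem_supported (Φ := LinearMap.id - plusPart c) hz fun S hS => ?_
  rcases Int.units_eq_one_or (S.marker c) with h | h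
  · simp [plusPart, h]
  · simpa [plusPart, h] using gen_mem_supported (P := {S | S ∈ P ∧ S.marker c = -1}) ⟨hS, h⟩

theorem plusPart_raise (c : C) (x : Dart C) (z : D.Chain) :
    plusPart c (raise x z) = raise x (plusPart c z) := by
  suffices plusPart c ∘ₗ raise x = (raise x ∘ₗ plusPart c : D.Chain →ₗ[ℤ] D.Chain) from
    LinearMap.congr_fun this z
  refine chain_hom_ext fun S => ?_
  rw [LinearMap.comp_apply, LinearMap.comp_apply]
  have hmem : ∀ v : ℤˣ, S.marker c = v →
      raise x (gen S) ∈ Finsupp.supported ℤ ℤ {S : D.EnhancedState | S.marker c = v} :=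
    fun v hv => raise_gen_mem_supported fun _ => hv
  rcases Int.units_eq_one_or (S.marker c) with h | h
  · rw [plusPart_eq_self (hmem 1 h), plusPart_eq_self (gen_mem_supported h)]
  · rw [plusPart_eq_zero (hmem _ h), plusPart_eq_zero (gen_mem_supported h), map_zero]

variable [Fintype C]

section Sigma

variable [DecidableEq C]

theorem sigma_eq_of_marker_eq_flipAt {S S' : D.EnhancedState} {c : C}
    (h : S'.marker = flipAt c S.marker) : S'.sigma = S.sigma - 2 * (S.marker c : ℤ) := by
  unfold EnhancedState.sigma
  have h1 := Finset.add_sum_erase Finset.univ (fun c => (S.marker c : ℤ)) (Finset.mem_univ c)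
  have h2 := Finset.add_sum_erase Finset.univ (fun c => (S'.marker c : ℤ)) (Finset.mem_univ c)
  have h3 : ∑ c' ∈ Finset.univ.erase c, (S'.marker c' : ℤ) =
      ∑ c' ∈ Finset.univ.erase c, (S.marker c' : ℤ) :=
    Finset.sum_congr rfl fun c' hc' => by rw [h, flipAt_of_ne (Finset.ne_of_mem_erase hc')]
  rw [h3] at h2
  have h4 : (S'.marker c : ℤ) = -(S.marker c : ℤ) := by rw [h, flipAt_self]; simp
  simp only [h4] at h2
  linarith

theorem FlipIncident.deg_eq {S S' : D.EnhancedState} {c : C} (h : FlipIncident c S S') :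
    S'.deg = S.deg - 2 * (S.marker c : ℤ) + 2 := by
  have h1 := sigma_eq_of_marker_eq_flipAt h.1
  have h2 := h.2.2
  unfold EnhancedState.deg
  linarith

end Sigma

theorem EnhancedState.setSign_deg (S : D.EnhancedState) (x : Dart C) (v : ℤˣ) :
    (S.setSign x v).deg = S.deg - 2 * (S.sg x : ℤ) + 2 * (v : ℤ) := by
  unfold EnhancedState.deg
  rw [S.setSign_tau, S.setSign_sigma]
  ring

variable [LinearOrder C]

/-- The sign of the edge of the cube at the crossing `c`. -/
def cubeSign (c : C) (t : State C) : ℤ := ∏ c' : C, if c < c' then (t c' : ℤ) else 1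

theorem cubeSign_eq (c : C) (S : D.EnhancedState) :
    cubeSign c S.marker = (-1) ^ negAbove c S := by
  unfold cubeSign negAbove
  rw [← Finset.prod_const, Finset.prod_filter]
  refine Finset.prod_congr rfl fun c' _ => ?_
  rcases Int.units_eq_one_or (S.marker c') with h | h <;> by_cases hc : c < c' <;> simp [h, hc]

theorem cubeSign_mul_self (c : C) (t : State C) : cubeSign c t * cubeSign c t = 1 := by
  unfold cubeSign
  rw [← Finset.prod_mul_distrib]
  refine Finset.prod_eq_one fun c' _ => ?_
  split_ifs
  · rcases Int.units_eq_one_or (t c') with h | h <;> simp [h]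
  · rfl

theorem cubeSign_flipAt_of_lt {c c' : C} (h : c < c') (t : State C) :
    cubeSign c (flipAt c' t) = -cubeSign c t := by
  unfold cubeSign
  rw [← Finset.mul_prod_erase _ _ (Finset.mem_univ c'),
    ← Finset.mul_prod_erase Finset.univ (fun d => if c < d then (t d : ℤ) else 1)
      (Finset.mem_univ c'), if_pos h, if_pos h, flipAt_self, Units.val_neg, neg_mul]
  congr 2
  refine Finset.prod_congr rfl fun d hd => ?_
  rw [flipAt_of_ne (Finset.ne_of_mem_erase hd)]

theorem cubeSign_flipAt_of_le {c c' : C} (h : c' ≤ c) (t : State C) :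
    cubeSign c (flipAt c' t) = cubeSign c t := by
  unfold cubeSign
  refine Finset.prod_congr rfl fun d _ => ?_
  split_ifs with hd
  · rw [flipAt_of_ne (h.trans_lt hd).ne']
  · rfl

/-- Multiplication by the sign of the edge of the cube at `c`. -/
noncomputable def signMap (c : C) : D.Chain →ₗ[ℤ] D.Chain :=
  Finsupp.linearCombination ℤ fun S => cubeSign c S.marker • gen S

theorem signMap_gen (c : C) (S : D.EnhancedState) :
    signMap c (gen S) = cubeSign c S.marker • gen S := by
  rw [signMap, gen, Finsupp.linearCombination_single, one_smul]

theorem signMap_of_mem_supported {c : C} {t : State C} {z : D.Chain}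
    (hz : z ∈ Finsupp.supported ℤ ℤ {S : D.EnhancedState | S.marker = t}) :
    signMap c z = cubeSign c t • z :=
  eq_of_mem_supported (Ψ := cubeSign c t • LinearMap.id) hz fun S hS => by
    rw [signMap_gen, show S.marker = t from hS]; rfl

theorem signMap_mem_supported {P : Set D.EnhancedState} {c : C} {z : D.Chain}
    (hz : z ∈ Finsupp.supported ℤ ℤ P) : signMap c z ∈ Finsupp.supported ℤ ℤ P :=
  map_mem_supported hz fun S hS => by
    rw [signMap_gen]; exact Submodule.smul_mem _ _ (gen_mem_supported hS)

theorem signMap_signMap (c : C) (z : D.Chain) : signMap c (signMap c z) = z := by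
  suffices signMap c ∘ₗ signMap c = (LinearMap.id : D.Chain →ₗ[ℤ] D.Chain) from
    LinearMap.congr_fun this z
  refine chain_hom_ext fun S => ?_
  rw [LinearMap.comp_apply, signMap_gen, map_smul, signMap_gen, smul_smul, cubeSign_mul_self,
    one_smul]
  rfl

/-- The cube sign depends on the markers alone, so it commutes with every map that leaves them
unchanged. -/
theorem signMap_comm_of_marker {Φ : D.Chain →ₗ[ℤ] D.Chain}
    (hΦ : ∀ S, Φ (gen S) ∈ Finsupp.supported ℤ ℤ {S' : D.EnhancedState | S'.marker = S.marker})
    (c : C) (z : D.Chain) : signMap c (Φ z) = Φ (signMap c z) := by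
  suffices signMap c ∘ₗ Φ = Φ ∘ₗ signMap c from LinearMap.congr_fun this z
  refine chain_hom_ext fun S => ?_
  rw [LinearMap.comp_apply, LinearMap.comp_apply, signMap_gen, map_smul,
    signMap_of_mem_supported (hΦ S)]

theorem signMap_raise (c : C) (x : Dart C) (z : D.Chain) :
    signMap c (raise x z) = raise x (signMap c z) :=
  signMap_comm_of_marker (fun _ => raise_gen_mem_supported fun _ => rfl) c z

theorem signMap_lower (c : C) (x : Dart C) (z : D.Chain) :
    signMap c (lower x z) = lower x (signMap c z) :=
  signMap_comm_of_marker (fun _ => lower_gen_mem_supported fun _ => rfl) c z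

theorem signMap_comm (c c' : C) (z : D.Chain) :
    signMap c (signMap c' z) = signMap c' (signMap c z) :=
  signMap_comm_of_marker (fun _ => signMap_mem_supported (gen_mem_supported rfl)) c z

theorem signMap_flipMap {c c' : C} {ε : ℤ}
    (h : ∀ t, cubeSign c (flipAt c' t) = ε * cubeSign c t) (z : D.Chain) :
    signMap c (flipMap c' z) = ε • flipMap c' (signMap c z) := by
  suffices signMap c ∘ₗ flipMap c' = (ε • (flipMap c' ∘ₗ signMap c) : D.Chain →ₗ[ℤ] D.Chain) from
    LinearMap.congr_fun this z
  refine chain_hom_ext fun S => ?_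
  rw [LinearMap.comp_apply, LinearMap.smul_apply, LinearMap.comp_apply, signMap_gen, map_smul,
    signMap_of_mem_supported (t := flipAt c' S.marker)
      (flipMap_gen_mem_supported fun S' hS' => hS'.1), h, mul_smul]

theorem signMap_flipMap_of_lt {c c' : C} (h : c < c') (z : D.Chain) :
    signMap c (flipMap c' z) = -flipMap c' (signMap c z) := by
  rw [signMap_flipMap (ε := -1) (fun t => by rw [cubeSign_flipAt_of_lt h, neg_one_mul]),
    neg_one_smul]

theorem signMap_flipMap_of_le {c c' : C} (h : c' ≤ c) (z : D.Chain) :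
    signMap c (flipMap c' z) = flipMap c' (signMap c z) := by
  rw [signMap_flipMap (ε := 1) (fun t => by rw [cubeSign_flipAt_of_le h, one_mul]), one_smul]

/-- The signed edge map of the cube at the crossing `c`, in both directions. -/
noncomputable def edgeMap (c : C) : D.Chain →ₗ[ℤ] D.Chain := flipMap c ∘ₗ signMap c

theorem edgeMap_apply (c : C) (z : D.Chain) : edgeMap c z = flipMap c (signMap c z) := rfl

theorem edgeMap_gen_mem_supported {P : Set D.EnhancedState} {c : C} {S : D.EnhancedState}
    (h : ∀ S', FlipIncident c S S' → S' ∈ P) : edgeMap c (gen S) ∈ Finsupp.supported ℤ ℤ P := by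
  rw [edgeMap_apply, signMap_gen, map_smul]
  exact Submodule.smul_mem _ _ (flipMap_gen_mem_supported h)

/-- The differential of the cube of the crossings in `A`. -/
noncomputable def partialDifferential (A : Finset C) : D.Chain →ₗ[ℤ] D.Chain :=
  ∑ c ∈ A, edgeMap c ∘ₗ plusPart c

theorem partialDifferential_apply (A : Finset C) (z : D.Chain) :
    partialDifferential A z = ∑ c ∈ A, edgeMap c (plusPart c z) := by
  rw [partialDifferential, LinearMap.sum_apply]; rfl

theorem partialDifferential_of_mem {A : Finset C} {c : C} (hc : c ∈ A) (z : D.Chain) :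
    partialDifferential A z =
      partialDifferential (A.erase c) z + edgeMap c (plusPart c z) := by
  rw [partialDifferential_apply, partialDifferential_apply, Finset.sum_erase_add _ _ hc]

theorem plusPart_edgeMap_of_ne {c c' : C} (h : c ≠ c') (z : D.Chain) :
    plusPart c (edgeMap c' z) = edgeMap c' (plusPart c z) := by
  suffices plusPart c ∘ₗ edgeMap c' = (edgeMap c' ∘ₗ plusPart c : D.Chain →ₗ[ℤ] D.Chain) from
    LinearMap.congr_fun this z
  refine chain_hom_ext fun S => ?_
  rw [LinearMap.comp_apply, LinearMap.comp_apply]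
  have hmem : ∀ v : ℤˣ, S.marker c = v →
      edgeMap c' (gen S) ∈ Finsupp.supported ℤ ℤ {S : D.EnhancedState | S.marker c = v} :=
    fun v hv => edgeMap_gen_mem_supported fun S' hS' => by
      rw [Set.mem_ofPred_eq, hS'.1, flipAt_of_ne h, hv]
  rcases Int.units_eq_one_or (S.marker c) with h | h
  · rw [plusPart_eq_self (hmem 1 h), plusPart_eq_self (gen_mem_supported h)]
  · rw [plusPart_eq_zero (hmem _ h), plusPart_eq_zero (gen_mem_supported h), map_zero]

theorem plusPart_edgeMap_plusPart (c : C) (z : D.Chain) :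
    plusPart c (edgeMap c (plusPart c z)) = 0 := by
  refine plusPart_eq_zero (map_mem_supported (plusPart_mem_supported (P := Set.univ) (by simp))
    fun S hS => edgeMap_gen_mem_supported fun S' hS' => ?_)
  rw [Set.mem_ofPred_eq, hS'.1, flipAt_self, hS.2]

variable [IsEmpty (Fin D.loops)]

theorem edgeMap_raise (c : C) (x : Dart C) (z : D.Chain) :
    edgeMap c (raise x z) = raise x (edgeMap c z) := by
  rw [edgeMap_apply, signMap_raise, flipMap_raise, edgeMap_apply]

theorem edgeMap_edgeMap (c : C) (a : ZMod 4) (z : D.Chain) :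
    edgeMap c (edgeMap c z) = raise (c, a) z + raise (c, a + 2) z := by
  rw [edgeMap_apply, edgeMap_apply, signMap_flipMap_of_le le_rfl, signMap_signMap,
    flipMap_flipMap_eq]

/-- Of two distinct crossings, a marker change at the larger one reverses the sign attached to the
smaller one, and not conversely; the unsigned maps commute. -/
theorem edgeMap_anticomm {c c' : C} (h : c ≠ c') (z : D.Chain) :
    edgeMap c (edgeMap c' z) = -edgeMap c' (edgeMap c z) := by
  simp only [edgeMap_apply]
  rcases h.lt_or_gt with h | h
  · rw [signMap_flipMap_of_lt h, signMap_flipMap_of_le h.le, map_neg, flipMap_comm, signMap_comm]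
  · rw [signMap_flipMap_of_lt h, signMap_flipMap_of_le h.le, map_neg, flipMap_comm, signMap_comm,
      neg_neg]

theorem edgeMap_lower_edgeMap {c : C} (a : ZMod 4) {z : D.Chain}
    (hz : z ∈ Finsupp.supported ℤ ℤ {S : D.EnhancedState | D.Joined S.marker c})
    (hr : raise (c, a) z = 0) : edgeMap c (lower (c, a + 2) (edgeMap c z)) = z := by
  rw [edgeMap_apply, edgeMap_apply, signMap_lower, signMap_flipMap_of_le le_rfl, signMap_signMap,
    flipMap_lower_flipMap a hz hr]

theorem partialDifferential_edgeMap {A : Finset C} {c : C} (hc : c ∉ A) (z : D.Chain) :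
    partialDifferential A (edgeMap c z) = -edgeMap c (partialDifferential A z) := by
  rw [partialDifferential_apply, partialDifferential_apply, map_sum, ← Finset.sum_neg_distrib]
  refine Finset.sum_congr rfl fun c' hc' => ?_
  have h : c' ≠ c := fun h => hc (h ▸ hc')
  rw [plusPart_edgeMap_of_ne h, edgeMap_anticomm h]

theorem partialDifferential_raise (A : Finset C) (x : Dart C) (z : D.Chain) :
    partialDifferential A (raise x z) = raise x (partialDifferential A z) := by
  simp only [partialDifferential_apply, plusPart_raise, edgeMap_raise, map_sum]

/-- Cross terms cancel by anticommutation. A single crossing contributes nothing twice, because its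
marker is negative after the first application. -/
theorem partialDifferential_partialDifferential (A : Finset C) (z : D.Chain) :
    partialDifferential A (partialDifferential A z) = 0 := by
  induction A using Finset.induction_on generalizing z with
  | empty => simp [partialDifferential_apply]
  | insert c A hc ih =>
    have h : ∀ z : D.Chain, partialDifferential (insert c A) z =
        partialDifferential A z + edgeMap c (plusPart c z) := fun z => by
      rw [partialDifferential_of_mem (Finset.mem_insert_self c A), Finset.erase_insert hc]
    have h1 : plusPart c (partialDifferential A z) = partialDifferential A (plusPart c z) := by
      simp only [partialDifferential_apply, map_sum]
      refine Finset.sum_congr rfl fun c' hc' => ?_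
      have hne : c ≠ c' := fun h => hc (h ▸ hc')
      rw [plusPart_edgeMap_of_ne hne]
      congr 1
      refine eq_of_mem_supported (Φ := plusPart c ∘ₗ plusPart c')
        (Ψ := plusPart c' ∘ₗ plusPart c) (P := Set.univ) (by simp) fun S _ => ?_
      rcases Int.units_eq_one_or (S.marker c) with h | h <;>
      rcases Int.units_eq_one_or (S.marker c') with h' | h' <;> simp [plusPart, h, h']
    rw [h, h, map_add, map_add, ih, partialDifferential_edgeMap hc, plusPart_edgeMap_plusPart, h1,
      add_zero, zero_add, neg_add_cancel]

/-- At a positive marker σ drops by 2, so preserving σ + 2τ means raising τ by 1: the incidence of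
the definition is the forward half of `FlipIncident`. -/
theorem differential_eq : D.differential = partialDifferential Finset.univ := by
  classical
  refine chain_hom_ext fun S => ?_
  rw [partialDifferential_apply, differential, gen, Finsupp.linearCombination_single, one_smul,
    Finset.sum_comm]
  refine Finset.sum_congr rfl fun c _ => ?_
  ext S'
  have hinc : Incident c S S' ↔ S.marker c = 1 ∧ FlipIncident c S S' := by
    constructor
    · rintro ⟨h1, h2, h3, h4, -, h6⟩
      have hm : S'.marker = flipAt c S.marker := by
        ext1 c'
        by_cases h : c' = c
        · subst h; rw [flipAt_self, h1, h2]
        · rw [h3 c' h, flipAt_of_ne h]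
      refine ⟨h1, hm, fun x hx => h4 x (not_exists.1 hx), ?_⟩
      have h7 := sigma_eq_of_marker_eq_flipAt hm
      rw [h1] at h7
      unfold EnhancedState.deg at h6
      simp at h7
      linarith
    · rintro ⟨h1, h⟩
      have h2 := h.deg_eq
      obtain ⟨hm, h3, h4⟩ := h
      refine ⟨h1, by rw [hm, flipAt_self, h1], fun c' hc' => by rw [hm, flipAt_of_ne hc'],
        fun x hx => h3 x (not_exists.2 hx), fun l => isEmptyElim l, ?_⟩
      rw [h1] at h2
      simpa using h2
  rw [Finsupp.finsetSum_apply, Finset.sum_eq_single S']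
  · rcases Int.units_eq_one_or (S.marker c) with h | h
    · rw [plusPart_eq_self (gen_mem_supported h), edgeMap_apply, signMap_gen, map_smul,
        Finsupp.smul_apply, flipMap_gen_apply]
      by_cases hf : FlipIncident c S S' <;> simp [hinc, h, hf, cubeSign_eq]
    · rw [plusPart_eq_zero (gen_mem_supported h), if_neg, map_zero]
      · rw [hinc, h]
        rintro ⟨h, -⟩
        exact absurd h (by decide)
  · intro T _ hT
    split_ifs
    · exact Finsupp.single_eq_of_ne' hT
    · rfl
  · simp

end LinkDiagram

/-! ### Homological algebra of cones. -/

/-- Cycles of bidegree `(i, j)` of which the multiple by `n` bounds are boundaries; for `n = 0` this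
is exactness. The differential lowers the first degree by `2`. -/
def BoundaryDivides {V : Type*} [AddCommGroup V] (d : V →ₗ[ℤ] V) (K : ℤ → ℤ → Submodule ℤ V)
    (i j n : ℤ) : Prop :=
  ∀ z ∈ K i j, d z = 0 → ∀ w ∈ K (i + 2) j, d w = n • z → ∃ w' ∈ K (i + 2) j, d w' = z

/-- The homology vanishes unless `a ≤ j - 2 i ≤ b`, and is torsion-free if `j - 2 i < a + 4`. -/
def ThinBetween {V : Type*} [AddCommGroup V] (d : V →ₗ[ℤ] V) (K : ℤ → ℤ → Submodule ℤ V)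
    (a b : ℤ) : Prop :=
  (∀ i j, j - 2 * i < a ∨ b < j - 2 * i → BoundaryDivides d K i j 0) ∧
    ∀ i j n, n ≠ 0 → j - 2 * i < a + 4 → BoundaryDivides d K i j n

section Cone

variable {V : Type*} [AddCommGroup V]

theorem BoundaryDivides.exact {d : V →ₗ[ℤ] V} {K : ℤ → ℤ → Submodule ℤ V} {i j : ℤ}
    (h : BoundaryDivides d K i j 0) {z : V} (hz : z ∈ K i j) (hdz : d z = 0) :
    ∃ w ∈ K (i + 2) j, d w = z :=
  h z hz hdz 0 (zero_mem _) (by simp)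

/-- The graded complex `(K, d)` is the cone of the map `E` from `(Kp, d')` to `(Km, d')`. -/
structure IsCone (d d' E : V →ₗ[ℤ] V) (K Kp Km : ℤ → ℤ → Submodule ℤ V) : Prop where
  le_p : ∀ i j, Kp i j ≤ K i j
  le_m : ∀ i j, Km i j ≤ K i j
  decomp : ∀ i j, ∀ z ∈ K i j, ∃ u ∈ Kp i j, ∃ v ∈ Km i j, u + v = z
  disj : ∀ i j, ∀ u ∈ Kp i j, ∀ v ∈ Km i j, u + v = 0 → u = 0 ∧ v = 0
  d_p : ∀ i j, ∀ u ∈ Kp i j, d u = d' u + E u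
  d_m : ∀ i j, ∀ v ∈ Km i j, d v = d' v
  map_p : ∀ i j, ∀ u ∈ Kp (i + 2) j, d' u ∈ Kp i j
  map_m : ∀ i j, ∀ v ∈ Km (i + 2) j, d' v ∈ Km i j
  map_E : ∀ i j, ∀ u ∈ Kp (i + 2) j, E u ∈ Km i j
  dd : ∀ z, d' (d' z) = 0
  dE : ∀ z, d' (E z) = -E (d' z)

namespace IsCone

variable {d d' E : V →ₗ[ℤ] V} {K Kp Km : ℤ → ℤ → Submodule ℤ V}

theorem d_eq_zero (h : IsCone d d' E K Kp Km) {i j : ℤ} {u v : V} (hu : u ∈ Kp i j)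
    (hv : v ∈ Km i j) (hd : d (u + v) = 0) : d' u = 0 ∧ d' v + E u = 0 := by
  rw [map_add, h.d_p _ _ u hu, h.d_m _ _ v hv, add_assoc, add_comm (E u)] at hd
  rw [← sub_add_cancel i 2] at hu hv
  exact h.disj _ _ _ (h.map_p _ _ _ hu) _ (add_mem (h.map_m _ _ _ hv) (h.map_E _ _ _ hu)) hd

theorem d_eq_smul (h : IsCone d d' E K Kp Km) {i j n : ℤ} {u v u' v' : V} (hu : u ∈ Kp i j)
    (hv : v ∈ Km i j) (hu' : u' ∈ Kp (i + 2) j) (hv' : v' ∈ Km (i + 2) j)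
    (hd : d (u' + v') = n • (u + v)) : d' u' = n • u ∧ d' v' + E u' = n • v := by
  rw [map_add, h.d_p _ _ u' hu', h.d_m _ _ v' hv'] at hd
  have h1 := h.disj i j (d' u' - n • u) (sub_mem (h.map_p _ _ _ hu') (Submodule.smul_mem _ _ hu))
    (d' v' + E u' - n • v) (sub_mem (add_mem (h.map_m _ _ _ hv') (h.map_E _ _ _ hu'))
      (Submodule.smul_mem _ _ hv)) (by
        rw [smul_add] at hd
        rw [← sub_eq_zero] at hd
        rw [← hd]; abel)
  exact ⟨sub_eq_zero.1 h1.1, sub_eq_zero.1 h1.2⟩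

/-- Splits the cycle as u + v, the given chain as u' + v' and the sought one as u₁ + v₁, so that
divisibility becomes a pair of equations for d'. -/
theorem boundaryDivides (h : IsCone d d' E K Kp Km) {i j n : ℤ}
    (key : ∀ u ∈ Kp i j, ∀ v ∈ Km i j, ∀ u' ∈ Kp (i + 2) j, ∀ v' ∈ Km (i + 2) j,
      d' u = 0 → d' v = -E u → d' u' = n • u → d' v' = n • v - E u' →
      ∃ u₁ ∈ Kp (i + 2) j, ∃ v₁ ∈ Km (i + 2) j, d' u₁ = u ∧ d' v₁ = v - E u₁) :
    BoundaryDivides d K i j n := by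
  intro z hz hdz w hw hdw
  obtain ⟨u, hu, v, hv, rfl⟩ := h.decomp _ _ z hz
  obtain ⟨u', hu', v', hv', rfl⟩ := h.decomp _ _ w hw
  obtain ⟨h1, h2⟩ := h.d_eq_zero hu hv hdz
  obtain ⟨h3, h4⟩ := h.d_eq_smul hu hv hu' hv' hdw
  obtain ⟨u₁, hu₁, v₁, hv₁, h5, h6⟩ := key u hu v hv u' hu' v' hv' h1 (eq_neg_of_add_eq_zero_left h2)
    h3 (eq_sub_of_add_eq h4)
  refine ⟨u₁ + v₁, add_mem (h.le_p _ _ hu₁) (h.le_m _ _ hv₁), ?_⟩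
  rw [map_add, h.d_p _ _ u₁ hu₁, h.d_m _ _ v₁ hv₁, h5, h6]
  abel

/-- The long exact sequence of the cone, carried out on chains. For torsion, dividing the u
component leaves a cycle that must itself be a boundary before the v component can be divided. -/
theorem thinBetween (h : IsCone d d' E K Kp Km) {a b : ℤ} (hp : ThinBetween d' Kp a b)
    (hm : ThinBetween d' Km a b) : ThinBetween d K a b := by
  have hstep : ∀ {i j} {u v u₁ : V}, u ∈ Kp i j → v ∈ Km i j → u₁ ∈ Kp (i + 2) j → d' v = -E u →
      d' u₁ = u → v - E u₁ ∈ Km i j ∧ d' (v - E u₁) = 0 := by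
    intro i j u v u₁ hu hv hu₁ hdv hdu
    refine ⟨sub_mem hv (h.map_E _ _ _ hu₁), ?_⟩
    rw [map_sub, h.dE, hdu, hdv]; abel
  refine ⟨fun i j hij => h.boundaryDivides ?_, fun i j n hn hij => h.boundaryDivides ?_⟩
  · intro u hu v hv _ _ _ _ hdu hdv _ _
    obtain ⟨u₁, hu₁, hdu₁⟩ := (hp.1 i j hij).exact hu hdu
    obtain ⟨h1, h2⟩ := hstep hu hv hu₁ hdv hdu₁
    obtain ⟨v₁, hv₁, hdv₁⟩ := (hm.1 i j hij).exact h1 h2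
    exact ⟨u₁, hu₁, v₁, hv₁, hdu₁, hdv₁⟩
  · intro u hu v hv u' hu' v' hv' hdu hdv hdu' hdv'
    obtain ⟨u₁, hu₁, hdu₁⟩ := hp.2 i j n hn hij u hu hdu u' hu' hdu'
    obtain ⟨h1, h2⟩ := hstep hu hv hu₁ hdv hdu₁
    -- Bidegree (i + 2, j) lies on the diagonal j - 2i - 4 < a, where the homology vanishes.
    obtain ⟨x, hx, hdx⟩ := (hp.1 (i + 2) j (Or.inl (by omega))).exact
      (sub_mem hu' (Submodule.smul_mem _ n hu₁)) (by rw [map_sub, map_smul, hdu', hdu₁, sub_self])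
    obtain ⟨v₁, hv₁, hdv₁⟩ := hm.2 i j n hn hij _ h1 h2 (v' - E x)
      (sub_mem hv' (h.map_E _ _ _ hx)) (by
        rw [map_sub, hdv', h.dE, hdx, map_sub, map_smul, smul_sub]; abel)
    exact ⟨u₁, hu₁, v₁, hv₁, hdu₁, hdv₁⟩

/-- If `E` is onto with kernel the image of an injective backward map, also given by `E`, then the
homology of the cone is that of `Km`, shifted. -/
theorem boundaryDivides_of_surjective (h : IsCone d d' E K Kp Km)
    (hback : ∀ i j, ∀ y ∈ Km i j, E y ∈ Kp (i + 2) (j + 4))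
    (hsurj : ∀ i j, ∀ v ∈ Km i j, ∃ w ∈ Kp (i + 2) j, E w = v)
    (hker : ∀ i j, ∀ u ∈ Kp i j, E u = 0 → ∃ y ∈ Km (i - 2) (j - 4), E y = u)
    (hinj : ∀ i j, ∀ y ∈ Km i j, E y = 0 → y = 0)
    (hEE : ∀ i j, ∀ y ∈ Km i j, E (E y) = 0) {i j n : ℤ}
    (hm : BoundaryDivides d' Km (i - 2) (j - 4) n) : BoundaryDivides d K i j n := by
  refine h.boundaryDivides ?_
  intro u hu v hv u' hu' v' hv' hdu hdv hdu' hdv'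
  -- Subtracting the boundary of a lift w of v removes the Km component. What is left lies in the
  -- kernel of E, so it is E y with y a cycle of Km; the same is done below to the bounding chain of
  -- the n-fold multiple.
  obtain ⟨w, hw, hEw⟩ := hsurj i j v hv
  have hu1 : u - d' w ∈ Kp i j := sub_mem hu (h.map_p _ _ _ hw)
  obtain ⟨y, hy, hEy⟩ := hker i j (u - d' w) hu1 (by
    rw [map_sub, ← neg_eq_iff_eq_neg.2 (h.dE w), hEw, hdv]; abel)
  have hy' : y ∈ Km (i - 4 + 2) (j - 4) := by convert hy using 2; ring
  have hdy : d' y = 0 := by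
    refine hinj _ _ _ (h.map_m _ _ _ hy') ?_
    rw [← neg_eq_zero, ← h.dE, hEy, map_sub, hdu, h.dd, sub_zero]
  obtain ⟨x, hx, hEx⟩ := hsurj (i + 2) j v' hv'
  have hw2 : u' - n • w - d' x ∈ Kp (i + 2) j :=
    sub_mem (sub_mem hu' (Submodule.smul_mem _ _ hw)) (h.map_p _ _ _ hx)
  obtain ⟨y₂, hy₂, hEy₂⟩ := hker _ _ _ hw2 (by
    rw [map_sub, map_sub, map_smul, ← neg_eq_iff_eq_neg.2 (h.dE x), hEx, hEw, hdv']; abel)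
  have hy₂' : y₂ ∈ Km (i - 2 + 2) (j - 4) := by convert hy₂ using 2; ring
  have hdy₂ : d' (-y₂) = n • y := by
    rw [← sub_eq_zero]
    refine hinj (i - 2) (j - 4) _ (sub_mem (h.map_m _ _ _ (neg_mem hy₂'))
      (Submodule.smul_mem _ _ hy)) ?_
    rw [map_sub, map_neg, map_neg, ← h.dE, hEy₂, map_smul, hEy, map_sub, map_sub, map_smul, h.dd,
      hdu', smul_sub]
    abel
  obtain ⟨y₃, hy₃, hdy₃⟩ := hm y hy hdy (-y₂) (neg_mem hy₂') hdy₂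
  have hEy₃ : E y₃ ∈ Kp (i + 2) j := by
    have := hback _ _ y₃ hy₃
    convert this using 2 <;> ring
  refine ⟨w - E y₃, sub_mem hw hEy₃, 0, zero_mem _, ?_, ?_⟩
  · rw [map_sub, h.dE, hdy₃, hEy]; abel
  · rw [map_zero, map_sub, hEw, hEE _ _ y₃ hy₃]; abel

/-- If `E` is injective and its image is the kernel of a backward map, also given by `E`, which is
onto, then the homology of the cone is that of `Kp`, shifted. -/
theorem boundaryDivides_of_injective (h : IsCone d d' E K Kp Km)
    (hback : ∀ i j, ∀ y ∈ Km i j, E y ∈ Kp (i + 2) (j + 4))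
    (hsurj : ∀ i j, ∀ u ∈ Kp i j, ∃ w ∈ Km (i - 2) (j - 4), E w = u)
    (hker : ∀ i j, ∀ v ∈ Km i j, E v = 0 → ∃ u ∈ Kp (i + 2) j, E u = v)
    (hinj : ∀ i j, ∀ u ∈ Kp i j, E u = 0 → u = 0)
    (hEE : ∀ i j, ∀ u ∈ Kp i j, E (E u) = 0) {i j n : ℤ}
    (hp : BoundaryDivides d' Kp (i + 2) (j + 4) n) : BoundaryDivides d K i j n := by
  refine h.boundaryDivides ?_
  intro u hu v hv u' hu' v' hv' hdu hdv hdu' hdv'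
  -- E v is the cycle of Kp that represents the class of u + v. Once it bounds, a lift x' of the
  -- bounding chain corrects v into the kernel of E, which is the image of Kp.
  obtain ⟨x, hx, hdx⟩ := hp (E v) (hback _ _ v hv) (by rw [h.dE, hdv, map_neg, hEE _ _ u hu]; simp)
    (-E v') (neg_mem (hback _ _ v' hv')) (by
      rw [map_neg, h.dE, hdv', map_sub, hEE _ _ u' hu', map_smul]; simp)
  obtain ⟨x', hx', hEx'⟩ := hsurj _ _ x hx
  have hx'' : x' ∈ Km (i + 2) j := by convert hx' using 2 <;> ring
  obtain ⟨u₁, hu₁, hEu₁⟩ := hker i j (v + d' x') (add_mem hv (h.map_m _ _ _ hx'')) (by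
    rw [map_add, ← neg_eq_iff_eq_neg.2 (h.dE x'), hEx', hdx]; abel)
  refine ⟨u₁, hu₁, -x', neg_mem hx'', ?_, ?_⟩
  · rw [← sub_eq_zero]
    refine hinj i j _ (sub_mem (h.map_p _ _ _ hu₁) hu) ?_
    rw [map_sub, ← neg_eq_iff_eq_neg.2 (h.dE u₁), hEu₁, map_add, h.dd, hdv]; abel
  · rw [map_neg, hEu₁]; abel

end IsCone

end Cone

/-! ### Connected partial smoothings, reduced chains, and the induction on crossings. -/

namespace LinkDiagram

section Connected

variable {C : Type*} {D : LinkDiagram C}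

/-- The states `s` and `t` agree outside `A`. -/
def AgreeOff (A : Finset C) (s t : State C) : Prop := ∀ c ∉ A, t c = s c

/-- The diagram obtained by smoothing the crossings outside `A` according to `s` is connected. -/
def IsConnectedOff (D : LinkDiagram C) (A : Finset C) (s : State C) : Prop :=
  ∀ r : Setoid (Dart C), (∀ x, r x (D.glue x)) → (∀ x, x.1 ∉ A → r x (D.arc s x)) →
    (∀ x y, x.1 ∈ A → x.1 = y.1 → r x y) → ∀ x y, r x y

theorem IsConnectedOff.circleOf_eq {s : State C} (h : D.IsConnectedOff ∅ s) (x y : Dart C) :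
    D.circleOf s x = D.circleOf s y :=
  h (Setoid.ker (D.circleOf s)) (fun x => (D.circleOf_glue s x).symm)
    (fun x _ => (D.circleOf_arc s x).symm) (by simp) x y

/-- Following fixed arcs from b, one must reach an unsmoothed crossing. Otherwise the darts tied to
b in all remaining states avoid A, and being such a dart is invariant under all the moves that make
the diagram connected. -/
theorem IsConnectedOff.exists_circleOf_eq {A : Finset C} {s : State C}
    (h : D.IsConnectedOff A s) (hA : A.Nonempty) (b : Dart C) :
    ∃ c ∈ A, ∃ a : ZMod 4, ∀ t, AgreeOff A s t → D.circleOf t b = D.circleOf t (c, a) := by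
  by_contra! hcon
  let K : Dart C → Prop := fun x => ∀ t, AgreeOff A s t → D.circleOf t b = D.circleOf t x
  have hKA : ∀ x : Dart C, x.1 ∈ A → ¬ K x := by
    intro x hx hK
    obtain ⟨t, ht, hne⟩ := hcon x.1 hx x.2
    exact hne (hK t ht)
  obtain ⟨c, hc⟩ := hA
  have hK := h (Setoid.ker K) (fun x => ?_) (fun x hx => ?_) (fun x y hx hxy => ?_) b (c, 0)
  · exact hKA (c, 0) hc ((show K b = K (c, 0) from hK) ▸ fun t _ => rfl)
  · refine propext (forall₂_congr fun t _ => ?_)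
    rw [D.circleOf_glue]
  · refine propext (forall₂_congr fun t ht => ?_)
    rw [← D.arc_congr (ht x.1 hx), D.circleOf_arc]
  · exact propext (iff_of_false (hKA x hx) (hKA y (hxy ▸ hx)))

/-- The circle that passes twice through c in the state t connects all four darts at c, so the
identification of these darts is no longer needed. -/
theorem IsConnectedOff.erase [DecidableEq C] {A : Finset C} {s t : State C} {c : C} {v : ℤˣ}
    (h : D.IsConnectedOff A s) (ht : AgreeOff (A.erase c) (Function.update s c v) t)
    (hj : D.Joined t c) : D.IsConnectedOff (A.erase c) (Function.update s c v) := by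
  intro r hglue harc hcross
  refine h r hglue (fun x hx => ?_) (fun x y hx hxy => ?_)
  · by_cases hxc : x.1 = c
    · refine D.rel_of_circleOf_eq (t := t) r hglue (fun x => ?_)
        (hj.circleOf_eq ⟨x.2, by rw [← hxc]⟩ ⟨(D.arc s x).2, by rw [← hxc]; rfl⟩)
      by_cases hxA : x.1 ∈ A.erase c
      · exact hcross _ _ hxA rfl
      · rw [D.arc_congr (ht _ hxA)]; exact harc x hxA
    · rw [← D.arc_congr (t' := Function.update s c v) (by rw [Function.update_of_ne hxc])]
      exact harc x fun h => hx (Finset.mem_of_mem_erase h)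
  · by_cases hxc : x.1 = c
    · refine D.rel_of_circleOf_eq (t := t) r hglue (fun x => ?_)
        (hj.circleOf_eq ⟨x.2, by rw [← hxc]⟩ ⟨y.2, by rw [← hxc, hxy]⟩)
      by_cases hxA : x.1 ∈ A.erase c
      · exact hcross _ _ hxA rfl
      · rw [D.arc_congr (ht _ hxA)]; exact harc x hxA
    · exact hcross x y (Finset.mem_erase.2 ⟨hxc, hx⟩) hxy

section Agree

variable [DecidableEq C] {A : Finset C} {s : State C} {c : C}

theorem agreeOff_erase_update {v : ℤˣ} {t : State C} :
    AgreeOff (A.erase c) (Function.update s c v) t → t c = v := fun h => by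
  rw [h c (Finset.notMem_erase c A), Function.update_self]

theorem AgreeOff.of_erase (hc : c ∈ A) {v : ℤˣ} {t : State C}
    (h : AgreeOff (A.erase c) (Function.update s c v) t) : AgreeOff A s t := fun c' hc' => by
  have hne : c' ≠ c := by rintro rfl; exact hc' hc
  rw [h c' fun h => hc' (Finset.mem_of_mem_erase h), Function.update_of_ne hne]

theorem AgreeOff.erase {v : ℤˣ} {t : State C} (h : AgreeOff A s t) (hv : t c = v) :
    AgreeOff (A.erase c) (Function.update s c v) t := fun c' hc' => by
  by_cases hcc : c' = c
  · subst hcc; rw [Function.update_self, hv]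
  · rw [Function.update_of_ne hcc]
    exact h c' fun h => hc' (Finset.mem_erase.2 ⟨hcc, h⟩)

theorem AgreeOff.flipAt_erase {v : ℤˣ} {t : State C}
    (h : AgreeOff (A.erase c) (Function.update s c v) t) :
    AgreeOff (A.erase c) (Function.update s c (-v)) (flipAt c t) := fun c' hc' => by
  by_cases hcc : c' = c
  · subst hcc; rw [Function.update_self, flipAt_self, agreeOff_erase_update h]
  · rw [Function.update_of_ne hcc, flipAt_of_ne hcc, h c' hc', Function.update_of_ne hcc]

end Agree

end Connected

variable {C : Type*} {D : LinkDiagram C}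

/-- The dart (c, a + 2) lies on another circle than b, so lowering there keeps a chain reduced. -/
theorem raise_lower_of_base {b : Dart C} {c : C} {a : ZMod 4} {z : D.Chain}
    {P : Set D.EnhancedState} (hz : z ∈ Finsupp.supported ℤ ℤ P) (hr : raise b z = 0)
    (hb : ∀ S ∈ P, D.circleOf S.marker b = D.circleOf S.marker (c, a))
    (hj : ∀ S ∈ P, ¬ D.Joined S.marker c) : raise b (lower (c, a + 2) z) = 0 := by
  rw [← lower_raise_comm, hr, map_zero]
  have hne : ∀ S ∈ P, D.circleOf S.marker (c, a + 2) ≠ D.circleOf S.marker b := fun S hS h =>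
    hj S hS ((D.joined_iff _ _ a).2 (h.trans (hb S hS)).symm)
  exact Finsupp.supported_mono hne hz

variable [Fintype C]

/-- The enhanced states of bidegree `(i, j)` whose markers agree with `s` outside `A`. -/
def cell (D : LinkDiagram C) (A : Finset C) (s : State C) (i j : ℤ) : Set D.EnhancedState :=
  {S | AgreeOff A s S.marker ∧ S.sigma = i ∧ S.deg = j}

/-- The chains of bidegree `(i, j)` spanned by the states that agree with `s` outside `A`. -/
noncomputable def chainsOff (D : LinkDiagram C) (A : Finset C) (s : State C) (i j : ℤ) :
    Submodule ℤ D.Chain :=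
  Finsupp.supported ℤ ℤ (D.cell A s i j)

/-- The reduced chains: those in which the circle through the base point `b` is positive. -/
noncomputable def reducedOff (b : Dart C) (A : Finset C) (s : State C) (i j : ℤ) :
    Submodule ℤ D.Chain :=
  D.chainsOff A s i j ⊓ LinearMap.ker (raise b)

theorem raise_mem_chainsOff {A : Finset C} {s : State C} {i j : ℤ} (x : Dart C) {z : D.Chain}
    (hz : z ∈ D.chainsOff A s i j) : raise x z ∈ D.chainsOff A s i (j + 4) := by
  refine map_mem_supported hz fun S hS => raise_gen_mem_supported fun hx => ⟨hS.1, hS.2.1, ?_⟩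
  rw [EnhancedState.setSign_deg, hS.2.2, hx]
  simp; ring

theorem lower_mem_chainsOff {A : Finset C} {s : State C} {i j : ℤ} (x : Dart C) {z : D.Chain}
    (hz : z ∈ D.chainsOff A s i j) : lower x z ∈ D.chainsOff A s i (j - 4) := by
  refine map_mem_supported hz fun S hS => lower_gen_mem_supported fun hx => ⟨hS.1, hS.2.1, ?_⟩
  rw [EnhancedState.setSign_deg, hS.2.2, hx]
  simp; ring

/-- The sum of the markers of a state. -/
def markerSum (t : State C) : ℤ := ∑ c : C, (t c : ℤ)

/-- The one circle is positive, so τ = 1 and j - 2i = σ + 2 - 2σ. -/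
theorem deg_eq_of_mem_reducedOff_empty [IsEmpty (Fin D.loops)] {b : Dart C} {s : State C}
    (hs : ∀ x y, D.circleOf s x = D.circleOf s y) {i j : ℤ} {z : D.Chain}
    (hz : z ∈ reducedOff (D := D) b ∅ s i j) (h0 : z ≠ 0) : j - 2 * i = 2 - markerSum s := by
  classical
  obtain ⟨S, hS⟩ := Finsupp.ne_iff.1 h0
  have hsg : S.sg b = 1 := by
    by_contra h
    rw [eq_raise_lower (LinearMap.mem_ker.1 hz.2), raise_apply, if_neg h] at hS
    exact hS rfl
  have hcell : S ∈ D.cell ∅ s i j := by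
    by_contra h
    exact hS ((Finsupp.mem_supported' ℤ z).1 hz.1 S h)
  obtain ⟨hm, hi, hj⟩ := hcell
  obtain ⟨t, e⟩ := S
  obtain rfl : t = s := funext fun c => hm c (Finset.notMem_empty c)
  have htau : EnhancedState.tau (D := D) ⟨t, e⟩ = 1 := by
    unfold EnhancedState.tau
    rw [Fintype.sum_eq_single (D.circleOf t b)]
    · exact congrArg Units.val hsg
    · intro γ hγ
      obtain ⟨x, rfl⟩ := circleOf_surjective (D := D) t γ
      exact absurd (hs x b) hγ
  have hsig : EnhancedState.sigma (D := D) ⟨t, e⟩ = markerSum t := rfl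
  unfold EnhancedState.deg at hj
  rw [htau] at hj
  linarith

variable [LinearOrder C]

theorem reducedOff_erase_le {b : Dart C} {A : Finset C} {s : State C} {c : C} (hc : c ∈ A) (v : ℤˣ) (i j : ℤ) :
    reducedOff b (A.erase c) (Function.update s c v) i j ≤ reducedOff (D := D) b A s i j :=
  inf_le_inf_right _ (Finsupp.supported_mono fun _ hS => ⟨hS.1.of_erase hc, hS.2⟩)

theorem edgeMap_mem_chainsOff {A : Finset C} {s s' : State C} {c : C} {v : ℤˣ} {i j i' j' : ℤ}
    (hv : ∀ t, AgreeOff A s t → t c = v) (hs : ∀ t, AgreeOff A s t → AgreeOff A s' (flipAt c t))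
    (hi : i' = i - 2 * (v : ℤ)) (hj : j' = j - 2 * (v : ℤ) + 2) {z : D.Chain}
    (hz : z ∈ D.chainsOff A s i j) : edgeMap c z ∈ D.chainsOff A s' i' j' := by
  refine map_mem_supported hz fun S hS => edgeMap_gen_mem_supported fun S' hS' => ⟨?_, ?_, ?_⟩
  · rw [hS'.1]; exact hs _ hS.1
  · rw [sigma_eq_of_marker_eq_flipAt hS'.1, hS.2.1, hv _ hS.1, hi]
  · rw [hS'.deg_eq, hS.2.2, hv _ hS.1, hj]

theorem partialDifferential_mem_chainsOff {A : Finset C} {s : State C} {i j : ℤ} {z : D.Chain}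
    (hz : z ∈ D.chainsOff A s (i + 2) j) : partialDifferential A z ∈ D.chainsOff A s i j := by
  rw [partialDifferential_apply]
  refine sum_mem fun c hc => map_mem_supported (plusPart_mem_supported (c := c) hz) fun S hS =>
    edgeMap_gen_mem_supported fun S' hS' => ⟨?_, ?_, ?_⟩
  · intro c' hc'
    have hne : c' ≠ c := by rintro rfl; exact hc' hc
    rw [hS'.1, flipAt_of_ne hne]
    exact hS.1.1 c' hc'
  · rw [sigma_eq_of_marker_eq_flipAt hS'.1, hS.1.2.1, hS.2]; simp
  · rw [hS'.deg_eq, hS.1.2.2, hS.2]; simp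

variable [IsEmpty (Fin D.loops)]

theorem partialDifferential_mem_reducedOff {b : Dart C} {A : Finset C} {s : State C} {i j : ℤ}
    {z : D.Chain} (hz : z ∈ reducedOff b A s (i + 2) j) :
    partialDifferential A z ∈ reducedOff (D := D) b A s i j := by
  refine ⟨partialDifferential_mem_chainsOff hz.1, ?_⟩
  change raise b _ = 0
  rw [← partialDifferential_raise, LinearMap.mem_ker.1 hz.2, map_zero]

theorem edgeMap_mem_reducedOff {b : Dart C} {A : Finset C} {s s' : State C} {c : C} {v : ℤˣ}
    {i j i' j' : ℤ} (hv : ∀ t, AgreeOff A s t → t c = v)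
    (hs : ∀ t, AgreeOff A s t → AgreeOff A s' (flipAt c t))
    (hi : i' = i - 2 * (v : ℤ)) (hj : j' = j - 2 * (v : ℤ) + 2) {z : D.Chain}
    (hz : z ∈ reducedOff b A s i j) : edgeMap c z ∈ reducedOff (D := D) b A s' i' j' := by
  refine ⟨edgeMap_mem_chainsOff hv hs hi hj hz.1, ?_⟩
  change raise b _ = 0
  rw [← edgeMap_raise, LinearMap.mem_ker.1 hz.2, map_zero]

section Step

variable {A : Finset C} {s : State C} {c : C}

/-- The signs are taken over all crossings, smoothed ones included, so the two halves carry the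
restricted differential itself and no sign change is needed. -/
theorem isCone_reducedOff (b : Dart C) (hc : c ∈ A) :
    IsCone (partialDifferential A) (partialDifferential (A.erase c)) (edgeMap c)
      (reducedOff (D := D) b A s) (reducedOff b (A.erase c) (Function.update s c 1))
      (reducedOff b (A.erase c) (Function.update s c (-1))) := by
  have hp : ∀ i j, ∀ u ∈ reducedOff (D := D) b (A.erase c) (Function.update s c 1) i j,
      plusPart c u = u := fun i j u hu =>
    plusPart_eq_self (Finsupp.supported_mono (fun S hS => agreeOff_erase_update hS.1) hu.1)
  have hm : ∀ i j, ∀ v ∈ reducedOff (D := D) b (A.erase c) (Function.update s c (-1)) i j,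
      plusPart c v = 0 := fun i j v hv =>
    plusPart_eq_zero (Finsupp.supported_mono (fun S hS => agreeOff_erase_update hS.1) hv.1)
  exact {
    le_p := reducedOff_erase_le hc 1
    le_m := reducedOff_erase_le hc (-1)
    decomp := fun i j z hz => by
      have hcell : ∀ v : ℤˣ, {S | S ∈ D.cell A s i j ∧ S.marker c = v} ⊆
          D.cell (A.erase c) (Function.update s c v) i j :=
        fun v S hS => ⟨hS.1.1.erase hS.2, hS.1.2⟩
      have hr : raise b (plusPart c z) = 0 := by
        rw [← plusPart_raise, LinearMap.mem_ker.1 hz.2, map_zero]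
      refine ⟨plusPart c z, ⟨?_, hr⟩, z - plusPart c z, ⟨?_, ?_⟩, add_sub_cancel _ _⟩
      · exact Finsupp.supported_mono (hcell (1))
          (plusPart_mem_supported (P := D.cell A s i j) (c := c) hz.1)
      · exact Finsupp.supported_mono (hcell (-1))
          (sub_plusPart_mem_supported (P := D.cell A s i j) (c := c) hz.1)
      · change raise b _ = 0
        rw [map_sub, hr, LinearMap.mem_ker.1 hz.2, sub_zero]
    disj := fun i j u hu v hv huv => by
      have h := congrArg (plusPart c) huv
      rw [map_add, hp i j u hu, hm i j v hv, map_zero, add_zero] at h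
      exact ⟨h, by rwa [h, zero_add] at huv⟩
    d_p := fun i j u hu => by rw [partialDifferential_of_mem hc, hp i j u hu]
    d_m := fun i j v hv => by
      rw [partialDifferential_of_mem hc, hm i j v hv, map_zero, add_zero]
    map_p := fun i j u hu => partialDifferential_mem_reducedOff hu
    map_m := fun i j v hv => partialDifferential_mem_reducedOff hv
    map_E := fun i j u hu => edgeMap_mem_reducedOff (v := 1)
      (fun _ => agreeOff_erase_update) (fun _ h => h.flipAt_erase) (by simp) (by simp) hu
    dd := partialDifferential_partialDifferential _
    dE := partialDifferential_edgeMap (Finset.notMem_erase c A) }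

end Step

section Bypass

variable {b : Dart C} {c : C} {a : ZMod 4} {z : D.Chain} {P : Set D.EnhancedState}

/-- Local model for the three lemmas of this section: reduced chains are X where c is joined and X ⊗
1, X ⊗ X where it is not, with the first factor at (c, a). Here X splits to X ⊗ X, is lowered to X ⊗
1 and merges back to X. So the split is injective and the merge onto. -/
theorem edgeMap_lower_edgeMap_of_base (hz : z ∈ Finsupp.supported ℤ ℤ P) (hr : raise b z = 0)
    (hb : ∀ S ∈ P, D.circleOf S.marker b = D.circleOf S.marker (c, a))
    (hj : ∀ S ∈ P, D.Joined S.marker c) :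
    edgeMap c (lower (c, a + 2) (edgeMap c z)) = z := by
  refine edgeMap_lower_edgeMap a (Finsupp.supported_mono hj hz) ?_
  rw [← raise_eq_of_mem_supported (x := b) (Finsupp.supported_mono hb hz), hr]

theorem edgeMap_edgeMap_of_joined (hz : z ∈ Finsupp.supported ℤ ℤ P) (hr : raise b z = 0)
    (hb : ∀ S ∈ P, D.circleOf S.marker b = D.circleOf S.marker (c, a))
    (hj : ∀ S ∈ P, D.Joined S.marker c) : edgeMap c (edgeMap c z) = 0 := by
  have h1 := raise_eq_of_mem_supported (x := b) (y := (c, a)) (Finsupp.supported_mono hb hz)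
  have h2 := raise_eq_of_mem_supported (x := b) (y := (c, a + 2)) (z := z)
    (Finsupp.supported_mono (fun S hS => (hb S hS).trans ((D.joined_iff _ _ a).1 (hj S hS))) hz)
  rw [edgeMap_edgeMap c a, ← h1, ← h2, hr, add_zero]

/-- The kernel of the merge is spanned by X ⊗ X, the split of X. Applying the edge map twice gives
zero on such z, which says that z is killed by X at (c, a + 2), hence recovered from its lowering.
-/
theorem edgeMap_edgeMap_lower (hz : z ∈ Finsupp.supported ℤ ℤ P) (hr : raise b z = 0)
    (hb : ∀ S ∈ P, D.circleOf S.marker b = D.circleOf S.marker (c, a))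
    (hj : ∀ S ∈ P, ¬ D.Joined S.marker c) (hE : edgeMap c z = 0) :
    edgeMap c (edgeMap c (lower (c, a + 2) z)) = z := by
  have hlow : lower (c, a + 2) z ∈ Finsupp.supported ℤ ℤ
      {S : D.EnhancedState | D.circleOf S.marker b = D.circleOf S.marker (c, a)} :=
    map_mem_supported hz fun S hS => lower_gen_mem_supported fun _ => hb S hS
  have h1 := edgeMap_edgeMap c a z
  rw [hE, map_zero, ← raise_eq_of_mem_supported (x := b) (Finsupp.supported_mono hb hz), hr,
    zero_add] at h1
  have h2 := raise_lower_add_lower_raise (c, a + 2) z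
  rw [← h1, map_zero, add_zero] at h2
  rw [edgeMap_edgeMap c a, ← raise_eq_of_mem_supported hlow, raise_lower_of_base hz hr hb hj,
    zero_add, h2]

end Bypass

/-- The reduced homology of a partial smoothing is supported on the diagonals of the states with
a single circle, and it is torsion-free on the lowest of them. -/
theorem thinBetween_reducedOff {b : Dart C} {lo hi : ℤ} {A : Finset C} {s : State C}
    (hconn : D.IsConnectedOff A s)
    (hbound : ∀ t, AgreeOff A s t → (∀ x y, D.circleOf t x = D.circleOf t y) →
      lo ≤ 2 - markerSum t ∧ 2 - markerSum t ≤ hi) :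
    ThinBetween (partialDifferential A) (reducedOff (D := D) b A s) lo hi := by
  induction hn : A.card generalizing A s with
  | zero =>
    rw [Finset.card_eq_zero] at hn
    subst hn
    have hs := hconn.circleOf_eq
    have hb := hbound s (fun _ _ => rfl) hs
    refine ⟨fun i j hij z hz _ w hw _ => ⟨0, zero_mem _, ?_⟩,
      fun i j n hn hij z hz _ w hw hdw => ⟨0, zero_mem _, ?_⟩⟩
    · rw [map_zero, eq_comm]
      by_contra h0
      have := deg_eq_of_mem_reducedOff_empty hs hz h0
      omega
    · rw [partialDifferential_apply, Finset.sum_empty, eq_comm, smul_eq_zero] at hdw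
      rw [map_zero, hdw.resolve_left hn]
  | succ n ih =>
    have hA : A.Nonempty := Finset.card_pos.1 (by omega)
    -- At this crossing the action of X at b equals that at (c, a) in every remaining state, which
    -- brings the local models into play.
    obtain ⟨c, hc, a, hca⟩ := hconn.exists_circleOf_eq hA b
    have hcard : (A.erase c).card = n := by rw [Finset.card_erase_of_mem hc]; omega
    have hih : ∀ v, D.IsConnectedOff (A.erase c) (Function.update s c v) →
        ThinBetween (partialDifferential (A.erase c))
          (reducedOff (D := D) b (A.erase c) (Function.update s c v)) lo hi := fun v hv =>
      ih hv (fun t ht => hbound t (ht.of_erase hc)) hcard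
    have hcone := isCone_reducedOff (D := D) (s := s) b hc
    have hb : ∀ v i j, ∀ S ∈ D.cell (A.erase c) (Function.update s c v) i j,
        D.circleOf S.marker b = D.circleOf S.marker (c, a) := fun v i j S hS =>
      hca _ (hS.1.of_erase hc)
    have hE : ∀ {v i j} {z : D.Chain} (i' j' : ℤ),
        z ∈ reducedOff b (A.erase c) (Function.update s c v) i j →
        i' = i - 2 * (v : ℤ) → j' = j - 2 * (v : ℤ) + 2 →
        edgeMap c z ∈ reducedOff b (A.erase c) (Function.update s c (-v)) i' j' :=
      fun i' j' hz hi' hj' => edgeMap_mem_reducedOff (fun _ => agreeOff_erase_update)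
        (fun _ h => h.flipAt_erase) hi' hj' hz
    -- if one smoothing is disconnected then `c` joins two circles there and one in the other
    have hdis : ∀ v, ¬ D.IsConnectedOff (A.erase c) (Function.update s c v) →
        (∀ t, AgreeOff (A.erase c) (Function.update s c v) t → ¬ D.Joined t c) ∧
        (∀ t, AgreeOff (A.erase c) (Function.update s c (-v)) t → D.Joined t c) ∧
        D.IsConnectedOff (A.erase c) (Function.update s c (-v)) := by
      intro v hv
      have h1 : ∀ t, AgreeOff (A.erase c) (Function.update s c v) t → ¬ D.Joined t c :=
        fun t ht hj => hv (hconn.erase ht hj)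
      have h2 : ∀ t, AgreeOff (A.erase c) (Function.update s c (-v)) t → D.Joined t c := by
        intro t ht
        have := h1 (flipAt c t) (by simpa using ht.flipAt_erase)
        rwa [joined_flipAt, not_not] at this
      exact ⟨h1, h2, hconn.erase (t := Function.update s c (-v)) (fun _ _ => rfl)
        (h2 _ fun _ _ => rfl)⟩
    by_cases hp : D.IsConnectedOff (A.erase c) (Function.update s c 1)
    · by_cases hm : D.IsConnectedOff (A.erase c) (Function.update s c (-1))
      · exact hcone.thinBetween (hih 1 hp) (hih (-1) hm)
      · obtain ⟨h1, h2, -⟩ := hdis (-1) hm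
        rw [neg_neg] at h2
        -- The positive smoothing carries the homology. The shift by (2, 4) leaves j - 2i unchanged,
        -- so both bounds transfer.
        have key : ∀ i j n, BoundaryDivides (partialDifferential (A.erase c))
            (reducedOff (D := D) b (A.erase c) (Function.update s c 1)) (i + 2) (j + 4) n →
            BoundaryDivides (partialDifferential A) (reducedOff (D := D) b A s) i j n := by
          intro i j n
          have hraise : ∀ {i j} {z : D.Chain},
              z ∈ reducedOff b (A.erase c) (Function.update s c (-1)) i j →
              lower (c, a + 2) z ∈
                reducedOff b (A.erase c) (Function.update s c (-1)) i (j - 4) :=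
            fun hz => ⟨lower_mem_chainsOff _ hz.1,
              raise_lower_of_base hz.1 hz.2 (hb _ _ _) fun S hS => h1 _ hS.1⟩
          refine hcone.boundaryDivides_of_injective ?_ ?_ ?_ ?_ ?_
          · intro i j y hy
            have := hE (i + 2) (j + 4) hy (by simp) (by simp; ring)
            rwa [neg_neg] at this
          · intro i j u hu
            exact ⟨_, hraise (hE (i - 2) j hu (by simp) (by simp)),
              edgeMap_lower_edgeMap_of_base hu.1 hu.2 (hb _ _ _) fun S hS => h2 _ hS.1⟩
          · intro i j v hv hEv
            have := hE (i + 2) j (hraise hv) (by simp) (by simp; ring)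
            rw [neg_neg] at this
            exact ⟨_, this,
              edgeMap_edgeMap_lower hv.1 hv.2 (hb _ _ _) (fun S hS => h1 _ hS.1) hEv⟩
          · intro i j u hu hEu
            rw [← edgeMap_lower_edgeMap_of_base hu.1 hu.2 (hb _ _ _) fun S hS => h2 _ hS.1, hEu,
              map_zero, map_zero]
          · intro i j u hu
            exact edgeMap_edgeMap_of_joined hu.1 hu.2 (hb _ _ _) fun S hS => h2 _ hS.1
        exact ⟨fun i j hij => key i j 0 ((hih 1 hp).1 _ _ (by omega)),
          fun i j n hn hij => key i j n ((hih 1 hp).2 _ _ n hn (by omega))⟩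
    · obtain ⟨h1, h2, hm⟩ := hdis 1 hp
      have key : ∀ i j n, BoundaryDivides (partialDifferential (A.erase c))
          (reducedOff (D := D) b (A.erase c) (Function.update s c (-1))) (i - 2) (j - 4) n →
          BoundaryDivides (partialDifferential A) (reducedOff (D := D) b A s) i j n := by
        intro i j n
        have hraise : ∀ {i j} {z : D.Chain},
            z ∈ reducedOff b (A.erase c) (Function.update s c 1) i j →
            lower (c, a + 2) z ∈
              reducedOff b (A.erase c) (Function.update s c 1) i (j - 4) :=
          fun hz => ⟨lower_mem_chainsOff _ hz.1,
            raise_lower_of_base hz.1 hz.2 (hb _ _ _) fun S hS => h1 _ hS.1⟩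
        have hback : ∀ {i j} {y : D.Chain},
            y ∈ reducedOff b (A.erase c) (Function.update s c (-1)) i j →
            edgeMap c y ∈
              reducedOff b (A.erase c) (Function.update s c 1) (i + 2) (j + 4) := by
          intro i j y hy
          have := hE (i + 2) (j + 4) hy (by simp) (by simp; ring)
          rwa [neg_neg] at this
        refine hcone.boundaryDivides_of_surjective ?_ ?_ ?_ ?_ ?_
        · exact fun i j y hy => hback hy
        · intro i j v hv
          have := hraise (hback hv)
          rw [add_sub_cancel_right] at this
          exact ⟨_, this,
            edgeMap_lower_edgeMap_of_base hv.1 hv.2 (hb _ _ _) fun S hS => h2 _ hS.1⟩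
        · intro i j u hu hEu
          exact ⟨_, hE (i - 2) (j - 4) (hraise hu) (by simp) (by simp),
            edgeMap_edgeMap_lower hu.1 hu.2 (hb _ _ _) (fun S hS => h1 _ hS.1) hEu⟩
        · intro i j y hy hEy
          rw [← edgeMap_lower_edgeMap_of_base hy.1 hy.2 (hb _ _ _) fun S hS => h2 _ hS.1, hEy,
            map_zero, map_zero]
        · intro i j y hy
          exact edgeMap_edgeMap_of_joined hy.1 hy.2 (hb _ _ _) fun S hS => h2 _ hS.1
      exact ⟨fun i j hij => key i j 0 ((hih (-1) hm).1 _ _ (by omega)),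
        fun i j n hn hij => key i j n ((hih (-1) hm).2 _ _ n hn (by omega))⟩

/-- The passage from reduced to unreduced homology. -/
theorem thinBetween_chainsOff {b : Dart C} {lo hi : ℤ} {A : Finset C} {s : State C}
    (h : ThinBetween (partialDifferential A) (reducedOff (D := D) b A s) lo hi) :
    ThinBetween (partialDifferential A) (D.chainsOff A s) (lo - 4) hi := by
  -- Multiplication by X at b maps all chains onto the reduced ones, raising j by 4, with the
  -- reduced chains as kernel. The arguments below are the long exact sequence of this extension.
  have hX : ∀ {i j} {z : D.Chain}, z ∈ D.chainsOff A s i j →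
      raise b z ∈ reducedOff b A s i (j + 4) := fun hz =>
    ⟨raise_mem_chainsOff b hz, raise_raise_self b _⟩
  have hL : ∀ {i j} {w : D.Chain}, w ∈ reducedOff b A s i (j + 4) →
      ∃ v ∈ D.chainsOff A s i j, raise b v = w := by
    intro i j w hw
    have := lower_mem_chainsOff b hw.1
    rw [add_sub_cancel_right] at this
    exact ⟨_, this, (eq_raise_lower (LinearMap.mem_ker.1 hw.2)).symm⟩
  -- a chain whose raised boundary is a boundary can be corrected to a reduced one
  have hcorr : ∀ {i j} {z v : D.Chain}, z ∈ D.chainsOff A s i j → v ∈ D.chainsOff A s (i + 2) j →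
      partialDifferential A (raise b v) = raise b z →
      z - partialDifferential A v ∈ reducedOff b A s i j := by
    intro i j z v hz hv hd
    refine ⟨sub_mem hz (partialDifferential_mem_chainsOff hv), ?_⟩
    change raise b _ = 0
    rw [map_sub, ← partialDifferential_raise, hd, sub_self]
  have hdX : ∀ {z : D.Chain}, partialDifferential A z = 0 →
      partialDifferential A (raise b z) = 0 := fun hz => by
    rw [partialDifferential_raise, hz, map_zero]
  have hdd : ∀ {z v : D.Chain}, partialDifferential A z = 0 →
      partialDifferential A (z - partialDifferential A v) = 0 := fun hz => by
    rw [map_sub, hz, partialDifferential_partialDifferential, sub_zero]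
  refine ⟨fun i j hij z hz hdz _ _ _ => ?_, fun i j n hn hij z hz hdz w hw hdw => ?_⟩
  · obtain ⟨w, hw, hdw⟩ := (h.1 i (j + 4) (by omega)).exact (hX hz) (hdX hdz)
    obtain ⟨v, hv, rfl⟩ := hL hw
    obtain ⟨w₂, hw₂, hdw₂⟩ := (h.1 i j (by omega)).exact (hcorr hz hv hdw) (hdd hdz)
    exact ⟨v + w₂, add_mem hv hw₂.1, by rw [map_add, hdw₂, add_sub_cancel]⟩
  · obtain ⟨w₁, hw₁, hdw₁⟩ := h.2 i (j + 4) n hn (by omega) _ (hX hz) (hdX hdz) _ (hX hw)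
      (by rw [partialDifferential_raise, hdw, map_smul])
    obtain ⟨v, hv, rfl⟩ := hL hw₁
    have hw₂ : w - n • v ∈ D.chainsOff A s (i + 2) j :=
      sub_mem hw (Submodule.smul_mem _ _ hv)
    have hdw₂ : partialDifferential A (w - n • v) = n • (z - partialDifferential A v) := by
      rw [map_sub, map_smul, hdw, smul_sub]
    -- Bidegree (i + 2, j + 4) lies on the diagonal j - 2i < lo, where the reduced homology is zero.
    obtain ⟨w₃, hw₃, hdw₃⟩ := (h.1 (i + 2) (j + 4) (Or.inl (by omega))).exact (hX hw₂) (by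
      rw [partialDifferential_raise, hdw₂, map_smul, map_sub, ← partialDifferential_raise A b v,
        hdw₁, sub_self, smul_zero])
    obtain ⟨v₃, hv₃, rfl⟩ := hL hw₃
    obtain ⟨w₄, hw₄, hdw₄⟩ := h.2 i j n hn (by omega) _ (hcorr hz hv hdw₁) (hdd hdz) _
      (hcorr hw₂ hv₃ hdw₃) (by
        rw [map_sub, partialDifferential_partialDifferential, sub_zero, hdw₂])
    exact ⟨v + w₄, add_mem hv hw₄.1, by rw [map_add, hdw₄, add_sub_cancel]⟩

end LinkDiagram

/-! ### Counting circles: the extreme states of an alternating diagram and single-circle states. -/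

theorem FourValentMap.two_mul_card_le_card_edge {C : Type*} [Finite C] (G : FourValentMap C) :
    2 * Nat.card C ≤ Nat.card G.Edge := by
  classical
  have := Fintype.ofFinite C
  have := Fintype.ofFinite G.Edge
  have h := Finset.card_le_mul_card_image (f := G.edgeOf) Finset.univ 2 (fun e _ => by
    obtain ⟨x, rfl⟩ : ∃ x, G.edgeOf x = e := Quot.exists_rep e
    refine (Finset.card_le_card (t := {x, G.glue x}) fun y hy => ?_).trans Finset.card_le_two
    rw [Finset.mem_filter] at hy
    rcases (G.edgeOf_eq_iff x y).1 hy.2.symm with rfl | rfl <;> simp)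
  have h2 := h.trans (Nat.mul_le_mul_left 2 (Finset.card_le_univ _))
  rw [Finset.card_univ, Fintype.card_prod, ZMod.card] at h2
  rw [Nat.card_eq_fintype_card, Nat.card_eq_fintype_card]
  omega

namespace LinkDiagram

variable {C : Type*} {D : LinkDiagram C}

/-- In an alternating diagram a circle of an extreme state runs along the boundary of one face. The
corner after an underpassing dart is reached by the positive state, that after an overpassing dart
by the negative one, so no face is missed. -/
theorem IsAlternating.card_face_le [Finite C] [IsEmpty (Fin D.loops)] (h : D.IsAlternating) :
    Nat.card D.Face ≤ D.numCircles (posState C) + D.numCircles (negState C) := by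
  have hface : ∀ x : Dart C, D.faceOf ((D.glue x).1, (D.glue x).2 - 1) = D.faceOf x :=
    fun x => D.faceOf_faceNext x
  have hsub : ∀ a : ZMod 4, a + -1 = a - 1 := fun a => (sub_eq_add_neg a 1).symm
  let φ : D.Circle (posState C) → D.Face := Sum.elim (Quot.lift
    (fun x : Dart C => if D.isOver x then D.faceOf (x.1, x.2 - 1) else D.faceOf x) (by
      rintro ⟨c, a⟩ _ (rfl | rfl)
      · cases hO : D.isOver (c, a) <;> simp [h (c, a), hO, D.faceOf_glue, hface]
      · cases hO : D.isOver (c, a) <;>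
          simp [arc, posState, hO, isOver_next, isOver_sub_one])) isEmptyElim
  let ψ : D.Circle (negState C) → D.Face := Sum.elim (Quot.lift
    (fun x : Dart C => if D.isOver x then D.faceOf x else D.faceOf (x.1, x.2 - 1)) (by
      rintro ⟨c, a⟩ _ (rfl | rfl)
      · cases hO : D.isOver (c, a) <;> simp [h (c, a), hO, D.faceOf_glue, hface]
      · cases hO : D.isOver (c, a) <;>
          simp [arc, negState, hO, isOver_next, isOver_sub_one, hsub])) isEmptyElim
  have hfin : ∀ s, Finite (D.Circle s) := fun s => by unfold Circle; infer_instance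
  have hsurj : Function.Surjective (Sum.elim φ ψ) := by
    intro f
    obtain ⟨x, rfl⟩ : ∃ x, D.faceOf x = f := Quot.exists_rep f
    cases hO : D.isOver x
    · exact ⟨Sum.inl (D.circleOf _ x), if_neg (by simp [hO])⟩
    · exact ⟨Sum.inr (D.circleOf _ x), if_pos hO⟩
  have := Nat.card_le_card_of_surjective _ hsurj
  rwa [Nat.card_sum] at this

/-- In an alternating diagram the circles of the two extreme states are the faces. -/
theorem IsAlternating.card_add_two_le [Finite C] [Nonempty C] [IsEmpty (Fin D.loops)]
    (h : D.IsAlternating) :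
    Nat.card C + 2 ≤ D.numCircles (posState C) + D.numCircles (negState C) := by
  have h1 := h.card_face_le
  have h2 := D.two_mul_card_le_card_edge
  have h3 : 0 < Nat.card D.Component :=
    Nat.card_pos_iff.2 ⟨⟨D.componentOf (Classical.arbitrary C)⟩, inferInstance⟩
  have h4 := D.planar
  unfold FourValentMap.IsPlanar at h4
  omega

section Distance

/-- The extreme states of the alternating diagram obtained by changing the crossings in `T`, as
states of the original diagram. -/
theorem numCircles_changeCrossings [DecidableEq C] (T : Finset C) (s : State C) :
    (D.changeCrossings T).numCircles s =
      D.numCircles fun c => if c ∈ T then -s c else s c := by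
  have harc : (D.changeCrossings T).arc s = D.arc fun c => if c ∈ T then -s c else s c := by
    ext1 ⟨c, a⟩
    by_cases hc : c ∈ T <;> cases hO : D.isOver (c, a) <;>
      simp [arc, changeCrossings, hc, hO, sub_eq_add_neg]
  unfold numCircles Circle
  rw [harc]
  rfl

variable [Fintype C]

theorem markerSum_eq (t : State C) :
    markerSum t = (Fintype.card C : ℤ) - 2 * ((Finset.univ.filter fun c => t c = -1).card : ℤ) := by
  have h : ∀ c, (t c : ℤ) = 1 - 2 * if t c = -1 then 1 else 0 := fun c => by
    rcases Int.units_eq_one_or (t c) with h | h <;> simp [h]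
  unfold markerSum
  rw [Finset.sum_congr rfl fun c _ => h c, Finset.sum_sub_distrib, ← Finset.mul_sum,
    Finset.sum_boole]
  simp

theorem tau_allNeg (t : State C) : (EnhancedState.allNeg D t).tau = -(D.numCircles t : ℤ) := by
  unfold EnhancedState.tau numCircles
  rw [Nat.card_eq_fintype_card]
  change ∑ _γ : D.Circle t, ((-1 : ℤˣ) : ℤ) = _
  simp

theorem chainsOff_univ (s : State C) : D.chainsOff Finset.univ s = D.chainDeg := by
  ext1 i; ext1 j
  unfold chainsOff chainDeg cell
  congr 1
  ext S
  exact ⟨fun h => h.2, fun h => ⟨fun c hc => absurd (Finset.mem_univ c) hc, h⟩⟩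

variable [DecidableEq C] [IsEmpty (Fin D.loops)]

/-- On all-negative states τ is minus the number of circles, so the merge and split formulas for τ
count circles. -/
theorem numCircles_le_flipAt (t : State C) (c : C) :
    D.numCircles t ≤ D.numCircles (flipAt c t) + 1 := by
  by_cases hj : D.Joined t c
  · have h := tau_of_split (S := EnhancedState.allNeg D t)
      (S' := EnhancedState.allNeg D (flipAt c t)) rfl hj fun _ _ => rfl
    simp only [tau_allNeg, EnhancedState.allNeg_sg] at h
    simp at h
    omega
  · have h := tau_of_merge (S := EnhancedState.allNeg D t)
      (S' := EnhancedState.allNeg D (flipAt c t)) rfl hj fun _ _ => rfl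
    simp only [tau_allNeg, EnhancedState.allNeg_sg] at h
    simp at h
    omega

theorem numCircles_le_of_agreeOff {A : Finset C} {s t : State C} (h : AgreeOff A s t) :
    D.numCircles s ≤ D.numCircles t + A.card := by
  induction A using Finset.induction_on generalizing s with
  | empty =>
    have : t = s := funext fun c => h c (Finset.notMem_empty c)
    simp [this]
  | insert c A hc ih =>
    rw [Finset.card_insert_of_notMem hc]
    by_cases hts : t c = s c
    · have := ih (s := s) fun c' hc' => by
        by_cases h' : c' = c
        · rw [h', hts]
        · exact h c' (by simp [h', hc'])
      omega
    · have h1 := ih (s := flipAt c s) fun c' hc' => by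
        by_cases h' : c' = c
        · rw [h', flipAt_self]
          exact (Int.units_ne_iff_eq_neg.1 hts)
        · rw [flipAt_of_ne h']
          exact h c' (by simp [h', hc'])
      have h2 := numCircles_le_flipAt (D := D) s c
      omega

/-- The states of an almost alternating diagram with a single circle lie close to a diagonal. -/
theorem IsAlmostAlternating.bounds [Nonempty C] {k : ℕ} (h : D.IsAlmostAlternating k)
    {t : State C} (ht : ∀ x y, D.circleOf t x = D.circleOf t y) :
    (Fintype.card C : ℤ) - 2 * D.numCircles (negState C) - 4 * k + 4 ≤ 2 - markerSum t ∧
      2 - markerSum t ≤ 2 * D.numCircles (posState C) - Fintype.card C + 4 * k := by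
  obtain ⟨T, hT, halt⟩ := h
  have : IsEmpty (Fin (D.changeCrossings T).loops) := ‹IsEmpty (Fin D.loops)›
  have h1 := halt.card_add_two_le
  rw [numCircles_changeCrossings, numCircles_changeCrossings, Nat.card_eq_fintype_card] at h1
  set P : State C := fun c => if c ∈ T then -posState C c else posState C c with hP
  set Q : State C := fun c => if c ∈ T then -negState C c else negState C c with hQ
  have hPQ : ∀ c, Q c = -P c := fun c => by
    by_cases hc : c ∈ T <;> simp [hP, hQ, hc, posState, negState]
  have hone : D.numCircles t = 1 := by
    refine Nat.card_eq_one_iff_unique.2 ⟨⟨fun γ γ' => ?_⟩,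
      ⟨D.circleOf t (Classical.arbitrary C, 0)⟩⟩
    obtain ⟨x, rfl⟩ := circleOf_surjective (D := D) t γ
    obtain ⟨y, rfl⟩ := circleOf_surjective (D := D) t γ'
    exact ht x y
  -- P and Q are the extreme states of the alternating diagram and are opposite at every crossing; t
  -- therefore differs from P on H and from Q on the complement.
  set H := Finset.univ.filter fun c => t c ≠ P c with hH
  have h2 : D.numCircles P ≤ D.numCircles t + H.card :=
    numCircles_le_of_agreeOff fun c hc => by simpa [H] using hc
  have h3 : D.numCircles Q ≤ D.numCircles t + Hᶜ.card :=
    numCircles_le_of_agreeOff fun c hc => by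
      rw [hPQ]
      exact Int.units_ne_iff_eq_neg.1 (by simpa [H] using hc)
  have h4 : D.numCircles P ≤ D.numCircles (posState C) + T.card :=
    numCircles_le_of_agreeOff fun c hc => by simp [hP, hc]
  have h5 : D.numCircles Q ≤ D.numCircles (negState C) + T.card :=
    numCircles_le_of_agreeOff fun c hc => by simp [hQ, hc]
  set p := Finset.univ.filter fun c => t c = -1 with hp
  have h6 : p.card ≤ H.card + T.card := by
    refine (Finset.card_le_card fun c hc => ?_).trans (Finset.card_union_le _ _)
    by_cases hcT : c ∈ T
    · simp [hcT]
    · have : t c = -1 := by simpa [p] using hc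
      simp [H, hP, hcT, this, posState]
  have h7 : pᶜ.card ≤ Hᶜ.card + T.card := by
    refine (Finset.card_le_card fun c hc => ?_).trans (Finset.card_union_le _ _)
    by_cases hcT : c ∈ T
    · simp [hcT]
    · have h8 : t c ≠ -1 := by simpa [p] using hc
      have : t c = 1 := (Int.units_eq_one_or _).resolve_right h8
      simp [H, hP, hcT, this, posState]
  have h8 : markerSum t = (Fintype.card C : ℤ) - 2 * (p.card : ℤ) := markerSum_eq t
  have h9 := Finset.card_add_card_compl H
  have h10 := Finset.card_add_card_compl p
  -- Since |t| = 1 and |P| + |Q| ≥ N + 2, the distance estimates are equalities: |H| = |P| - 1 and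
  -- |Hᶜ| = |Q| - 1. Passing from P, Q to s₊, s₋ costs k circles, and from H to the negative markers
  -- of t another k crossings; doubling gives 4k.
  omega

end Distance

/-! ### From chains to homology groups. -/

section Final

variable [Fintype C]

theorem IsNonSplit.isConnectedOff_univ (h : D.IsNonSplit) (s : State C) :
    D.IsConnectedOff Finset.univ s := by
  intro r hglue _ hcross x y
  unfold IsNonSplit at h
  have hsub : Subsingleton D.Component :=
    (Finite.card_le_one_iff_subsingleton).1 (by omega)
  have key : ∀ c c', Relation.EqvGen
      (fun c c' : C => ∃ a b : ZMod 4, D.glue (c, a) = (c', b)) c c' →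
      ∀ a b : ZMod 4, r (c, a) (c', b) := by
    intro c c' hcc
    induction hcc with
    | rel c c' h =>
      obtain ⟨a, b, h⟩ := h
      intro a' b'
      have h1 := hglue (c, a)
      rw [h] at h1
      have h0 : r (c, a') (c, a) := hcross _ _ (Finset.mem_univ _) rfl
      have h2 : r (c', b) (c', b') := hcross _ _ (Finset.mem_univ _) rfl
      exact r.trans' h0 (r.trans' h1 h2)
    | refl c => exact fun a b => hcross _ _ (Finset.mem_univ _) rfl
    | symm c c' _ ih => exact fun a b => r.symm (ih b a)
    | trans c d e _ _ ih1 ih2 => exact fun a b => r.trans (ih1 a 0) (ih2 0 b)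
  exact key _ _ (Quot.eqvGen_exact (hsub.elim (D.componentOf x.1) (D.componentOf y.1))) x.2 y.2

variable [LinearOrder C]

/-- Without crossings the differential vanishes, σ = 0, and j - 2i = 2τ is at most twice the number
of circles in absolute value; the chain group is free. -/
theorem thinBetween_of_isEmpty [IsEmpty C] (k : ℕ) :
    ThinBetween D.differential D.chainDeg
      ((Fintype.card C : ℤ) - 2 * D.numCircles (negState C) - 4 * k)
      (2 * D.numCircles (posState C) - Fintype.card C + 4 * k) := by
  classical
  have hd : D.differential = 0 := chain_hom_ext fun S => by simp [differential]
  refine ⟨fun i j hij z hz _ _ _ _ => ⟨0, zero_mem _, ?_⟩,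
    fun i j n hn _ z _ _ w _ hdw => ⟨0, zero_mem _, ?_⟩⟩
  · rw [map_zero, eq_comm]
    by_contra h0
    obtain ⟨S, hS⟩ := Finsupp.ne_iff.1 h0
    obtain ⟨hi, hj⟩ : S.sigma = i ∧ S.deg = j := by
      by_contra h
      exact hS ((Finsupp.mem_supported' ℤ z).1 hz S h)
    have hsig : S.sigma = 0 := by simp [EnhancedState.sigma]
    have htau : |S.tau| ≤ D.numCircles S.marker := by
      unfold EnhancedState.tau numCircles
      refine (Finset.abs_sum_le_sum_abs _ _).trans ?_
      have habs : ∀ u : ℤˣ, |(u : ℤ)| = 1 := by decide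
      simp [Nat.card_eq_fintype_card, habs]
    rw [Subsingleton.elim (negState C) S.marker, Subsingleton.elim (posState C) S.marker,
      Fintype.card_eq_zero] at hij
    unfold EnhancedState.deg at hj
    rw [abs_le] at htau
    omega
  · rw [hd, LinearMap.zero_apply, eq_comm, smul_eq_zero] at hdw
    rw [map_zero, hdw.resolve_left hn]

theorem IsAlmostAlternating.thinBetween {k : ℕ} (hsplit : D.IsNonSplit)
    (halt : D.IsAlmostAlternating k) :
    ThinBetween D.differential D.chainDeg
      ((Fintype.card C : ℤ) - 2 * D.numCircles (negState C) - 4 * k)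
      (2 * D.numCircles (posState C) - Fintype.card C + 4 * k) := by
  rcases isEmpty_or_nonempty C with hC | hC
  · exact thinBetween_of_isEmpty k
  have hloops : D.loops = 0 := by
    have h3 : 0 < Nat.card D.Component :=
      Nat.card_pos_iff.2 ⟨⟨D.componentOf (Classical.arbitrary C)⟩, inferInstance⟩
    unfold IsNonSplit at hsplit
    omega
  have : IsEmpty (Fin D.loops) := by rw [hloops]; infer_instance
  -- The lower bound for single-circle states exceeds the end of the band by 4; the passage to
  -- unreduced homology gives this 4 back.
  have h := thinBetween_chainsOff (thinBetween_reducedOff (b := (Classical.arbitrary C, 0))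
    (hsplit.isConnectedOff_univ (posState C)) fun t _ ht => halt.bounds ht)
  rwa [chainsOff_univ, ← differential_eq, add_sub_cancel_right] at h

theorem subsingleton_khovanovHomology {i j : ℤ}
    (h : BoundaryDivides D.differential D.chainDeg i j 0) :
    Subsingleton (D.KhovanovHomology i j) := by
  rw [Submodule.Quotient.subsingleton_iff, eq_top_iff]
  rintro ⟨z, hz⟩ -
  exact h.exact hz.2 hz.1

theorem torsion_khovanovHomology_eq_bot {i j : ℤ}
    (h : ∀ n, n ≠ 0 → BoundaryDivides D.differential D.chainDeg i j n) :
    Submodule.torsion ℤ (D.KhovanovHomology i j) = ⊥ := by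
  rw [eq_bot_iff]
  intro x hx
  obtain ⟨n, hn⟩ := (Submodule.mem_torsion_iff x).1 hx
  induction x using Submodule.Quotient.induction_on with
  | H z =>
    obtain ⟨z, hz⟩ := z
    have hn' : (Submodule.Quotient.mk ((n : ℤ) • (⟨z, hz⟩ : D.cycles i j)) :
        D.KhovanovHomology i j) = 0 := hn
    rw [Submodule.Quotient.mk_eq_zero] at hn'
    obtain ⟨w, hw, hdw⟩ := hn'
    rw [Submodule.mem_bot, Submodule.Quotient.mk_eq_zero]
    exact h n (nonZeroDivisors.ne_zero n.2) z hz.2 hz.1 w hw hdw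

end Final

end LinkDiagram

theorem corollary5p8 {C : Type*} [Fintype C] [LinearOrder C] (D : LinkDiagram C) (k : ℕ)
    (hsplit : D.IsNonSplit) (halt : D.IsAlmostAlternating k)
    (hnug : ∀ c : C, ¬ D.IsNugatory c) :
    D.IsHThick (k : ℤ) (k : ℤ) ∧ D.IsTHThick (k : ℤ) ((k : ℤ) - 1) := by
  have h := LinkDiagram.IsAlmostAlternating.thinBetween hsplit halt
  constructor
  · intro i j hij
    refine LinkDiagram.subsingleton_khovanovHomology (h.1 i j ?_)
    unfold LinkDiagram.InBand at hij
    omega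
  · intro i j hij
    unfold LinkDiagram.InBand at hij
    refine LinkDiagram.torsion_khovanovHomology_eq_bot fun n hn => ?_
    -- The torsion band starts 4 above the homology band, exactly where torsion-freeness stops being
    -- known. The remaining case is above the upper end, where the homology itself vanishes.
    by_cases hlo : j - 2 * i <
        (Fintype.card C : ℤ) - 2 * D.numCircles (LinkDiagram.negState C) - 4 * k + 4
    · exact h.2 i j n hn hlo
    · intro z hz hdz w _ _
      exact (h.1 i j (by omega)).exact hz hdz
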